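/- Let $M$ be a connected, second countable, Hausdorff smooth Riemannian manifold of dimension $N$. For $x\in M$ and $r>0$ put $U_{x,r}=\exp_x(B_r(0))$, $B_r(0)\subset T_xM$. Say that $r>0$ satisfies the bounded geometry conditions if for every $x\in M$ the map $\exp_x:B_r(0)\to U_{x,r}$ is a diffeomorphism onto an open set, and the operator norms of the differentials of these maps and of their inverses are bounded uniformly in $x$. Assume that $M$ has bounded geometry, i.e. that such an $r$ exists. Let $H$ be a separable complex Hilbert space and let $P:M\to\mathcal L(H)$ be a map whose values are orthogonal projections, which is strongly differentiable ($x\mapsto P(x)\xi$ is $C^1$ for each $\xi\in H$) and satisfies $\sup_{x\in M}\|dP(x)\|<\infty$, where the strong derivative $df(x):\xi\mapsto d(f\xi)(x)$ of an operator-valued map is regarded as an operator with values in the Hilbert space tensor product with $T_x^*M$. Then there are numbers $0<r<s$ such that $s$ satisfies the bounded geometry conditions and $$4\,r\cdot\sup_{x\in M,\,v\in T_xM,\,|v|<s}\|d\exp_x(v)\|\cdot\sup_{x\in M}\|dP(x)\|<1,$$ and for all such $s$ and $r$ the following holds, with $U_x:=U_{x,r}$. 1. For $x\in M$ and $y\in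 U_x$ the operator $P(x)P(y)P(x)$ is invertible on $P(x)H$, and $W_x(y):=P(y)\,(P(x)P(y)P(x))^{-1/2}:P(x)H\to P(y)H$ is unitary. 2. Let $\mathrm{Im}(P)=\coprod_{x\in M}P(x)H$, let $\pi:\mathrm{Im}(P)\to M$ be the projection, and let $\psi_x:\pi^{-1}(U_x)\to U_x\times P(x)H$ be given by $\psi_x(\xi)=(y,W_x(y)^*\xi)$ for $\xi\in P(y)H$. The sets $V$ such that $V\subset\pi^{-1}(U_x)$ and $\psi_x(V)$ is open for some $x\in M$ form a basis of a topology on $\mathrm{Im}(P)$. 3. With this topology, $\mathrm{Im}(P)$, $\pi$ and the maps $\psi_x$ form a Hilbert bundle of bounded geometry. That is: the radius $r$ satisfies the bounded geometry conditions and is smaller than the injectivity radius of $M$; $\mathrm{Im}(P)$ is Hausdorff; $\pi$ is continuous and surjective; each $\psi_x$ is a fibre preserving homeomorphism; the Hilbert spaces $P(x)H$, $x\in M$, are separable and mutually unitarily isomorphic; and the transition maps $\tau_{x,y}=\psi_x\psi_y^{-1}:U_x\cap U_y\to\mathcal L(P(y)H,P(x)H)$ have unitary values, are strongly differentiable, and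 satisfy $\sup_{x,y\in M}\,\sup_{z\in U_x\cap U_y}\|d\tau_{x,y}(z)\|<\infty$. The same holds with one fixed fibre $P(x_0)H$, $x_0\in M$, after composing each $\psi_x$ with an arbitrary unitary $P(x)H\to P(x_0)H$. -/

import Mathlib

open Set TopologicalSpace Manifold Bundle
open scoped ContDiff ENNReal Topology InnerProduct

noncomputable section

/-! ### Geodesics, the exponential map and bounded geometry -/

section Manifold

variable {N : ℕ} {M : Type*} [TopologicalSpace M] [ChartedSpace (EuclideanSpace ℝ (Fin N)) M]

section Riemannian

variable [IsManifold (𝓡 N) ∞ M] [RiemannianBundle (fun x : M => TangentSpace (𝓡 N) x)]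

/-- The Riemannian metric in the coordinates of the chart at `x₀`: the inner product, at the point
with coordinates `u`, of the tangent vectors with coordinates `a` and `b`. -/
def chartMetric (x₀ : M) (u a b : EuclideanSpace ℝ (Fin N)) : ℝ :=
  let A : EuclideanSpace ℝ (Fin N) → TangentSpace (𝓡 N) ((extChartAt (𝓡 N) x₀).symm u) := fun c =>
    mfderiv 𝓘(ℝ, EuclideanSpace ℝ (Fin N)) (𝓡 N) (extChartAt (𝓡 N) x₀).symm u
      ((NormedSpace.fromTangentSpace (𝕜 := ℝ) u).symm c)
  inner ℝ (A a) (A b)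

/-- The Christoffel form of the first kind in the chart at `x₀`: with `a = ∂ᵢ`, `b = ∂ⱼ`, `w = ∂ₗ`
this is `(∂ᵢ gⱼₗ + ∂ⱼ gᵢₗ - ∂ₗ gᵢⱼ) / 2 = ∑ₖ gₖₗ Γᵏᵢⱼ`. -/
def christoffel (x₀ : M) (u a b w : EuclideanSpace ℝ (Fin N)) : ℝ :=
  (fderiv ℝ (fun u' => chartMetric x₀ u' b w) u a + fderiv ℝ (fun u' => chartMetric x₀ u' a w) u b
    - fderiv ℝ (fun u' => chartMetric x₀ u' a b) u w) / 2

/-- `γ` is a geodesic on the open set `J`: it is smooth there, and in every chart its coordinate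
expression `c` satisfies the geodesic equation `c'' + Γ(c', c') = 0` (paired with all `w`). -/
def IsGeodesicOn (γ : ℝ → M) (J : Set ℝ) : Prop :=
  ContMDiffOn 𝓘(ℝ, ℝ) (𝓡 N) ∞ γ J ∧
  ∀ t ∈ J, ∀ x₀ : M, γ t ∈ (extChartAt (𝓡 N) x₀).source →
    ∀ w : EuclideanSpace ℝ (Fin N),
      let c : ℝ → EuclideanSpace ℝ (Fin N) := fun s => extChartAt (𝓡 N) x₀ (γ s)
      chartMetric x₀ (c t) (deriv (deriv c) t) w + christoffel x₀ (c t) (deriv c t) (deriv c t) w = 0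

/-- `γ` is a geodesic, defined on an open interval around `[0, 1]`, that starts at `x` with
velocity `v`. -/
def IsGeodesicFrom (x : M) (v : TangentSpace (𝓡 N) x) (γ : ℝ → M) : Prop :=
  (∃ ε > 0, IsGeodesicOn (N := N) γ (Ioo (-ε) (1 + ε))) ∧
    (⟨γ 0, mfderiv 𝓘(ℝ, ℝ) (𝓡 N) γ 0 ((NormedSpace.fromTangentSpace (𝕜 := ℝ) (0 : ℝ)).symm 1)⟩ :
      TangentBundle (𝓡 N) M) = ⟨x, v⟩

open Classical in
/-- The Riemannian exponential map at `x`: the value at time `1` of the geodesic with initial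
position `x` and initial velocity `v` (and the value `x` if there is no such geodesic). -/
def expMap (x : M) (v : TangentSpace (𝓡 N) x) : M :=
  if h : ∃ γ : ℝ → M, IsGeodesicFrom x v γ then h.choose 1 else x

/-- The differential of the exponential map at `v`, as an operator between the Hilbert spaces
`T_x M` and `T_{exp_x v} M`. -/
def dexp (x : M) (v : TangentSpace (𝓡 N) x) :
    TangentSpace (𝓡 N) x →L[ℝ] TangentSpace (𝓡 N) (expMap x v) :=
  (mfderiv 𝓘(ℝ, TangentSpace (𝓡 N) x) (𝓡 N) (expMap x) v).comp
    (NormedSpace.fromTangentSpace (𝕜 := ℝ) v).symm.toContinuousLinearMap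

/-- The normal neighbourhood `U_{x,r} = exp_x (B_r(0))`. -/
def normalBall (x : M) (r : ℝ) : Set M :=
  expMap x '' Metric.ball (0 : TangentSpace (𝓡 N) x) r

/-- `exp_x` is defined on the ball `B_r(0) ⊆ T_x M` and restricts to the diffeomorphism `Φ` from
that ball onto an open subset of `M`. -/
def IsNormalChartInv (x : M) (r : ℝ)
    (Φ : PartialDiffeomorph 𝓘(ℝ, TangentSpace (𝓡 N) x) (𝓡 N) (TangentSpace (𝓡 N) x) M ∞) : Prop :=
  Φ.source = Metric.ball 0 r ∧
    ∀ v ∈ Metric.ball (0 : TangentSpace (𝓡 N) x) r,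
      (∃ γ : ℝ → M, IsGeodesicFrom x v γ) ∧ Φ v = expMap x v

variable (N M) in
/-- `r` is a positive radius such that every exponential map restricts to a diffeomorphism from the
ball of radius `r` onto an open set. -/
def IsInjRadius (r : ℝ) : Prop :=
  0 < r ∧ ∀ x : M, ∃ Φ : PartialDiffeomorph 𝓘(ℝ, TangentSpace (𝓡 N) x) (𝓡 N)
    (TangentSpace (𝓡 N) x) M ∞, IsNormalChartInv x r Φ

variable (N M) in
/-- `r` satisfies the bounded geometry conditions: the exponential maps are diffeomorphisms on balls
of radius `r`, and the differentials of the normal charts and of their inverses are bounded in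
operator norm, uniformly over all base points. -/
def IsBoundedGeometryRadius (r : ℝ) : Prop :=
  0 < r ∧ ∃ C : ℝ, ∀ x : M, ∃ Φ : PartialDiffeomorph 𝓘(ℝ, TangentSpace (𝓡 N) x) (𝓡 N)
    (TangentSpace (𝓡 N) x) M ∞, IsNormalChartInv x r Φ ∧
      (∀ v ∈ Metric.ball (0 : TangentSpace (𝓡 N) x) r, ‖dexp x v‖ ≤ C) ∧
      (∀ y ∈ Φ.target,
        ‖(NormedSpace.fromTangentSpace (𝕜 := ℝ) (Φ.symm y)).toContinuousLinearMap.comp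
            (mfderiv (𝓡 N) 𝓘(ℝ, TangentSpace (𝓡 N) x) Φ.symm y)‖ ≤ C)

variable (N M) in
/-- A Riemannian manifold of bounded geometry (of order `0`). -/
def BoundedGeometry : Prop :=
  ∃ r : ℝ, IsBoundedGeometryRadius N M r

end Riemannian

/-! ### Strongly differentiable operator-valued maps -/

section Strong

variable {F G : Type*} [NormedAddCommGroup F] [InnerProductSpace ℂ F]
  [NormedAddCommGroup G] [InnerProductSpace ℂ G]

variable (N) in
/-- `f` is strongly differentiable on the open set `U`: `z ↦ f z ξ` is `C¹` for every `ξ`. -/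
def StronglyDiffOn (f : M → F →L[ℂ] G) (U : Set M) : Prop :=
  ∀ ξ : F, ContMDiffOn (𝓡 N) 𝓘(ℝ, G) 1 (fun z => f z ξ) U

variable [IsManifold (𝓡 N) ∞ M] [RiemannianBundle (fun x : M => TangentSpace (𝓡 N) x)]

instance (z : M) : FiniteDimensional ℝ (TangentSpace (𝓡 N) z) :=
  inferInstanceAs (FiniteDimensional ℝ (EuclideanSpace ℝ (Fin N)))

variable (N) in
/-- The norm of the strong derivative `df(z) : F → G ⊗ T_z^* M`. In an orthonormal basis `(eᵢ)` of
`T_z M` one has `‖df(z)ξ‖² = ∑ᵢ ‖d(f ξ)(z) eᵢ‖²`. -/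
def strongDerivNorm (f : M → F →L[ℂ] G) (z : M) : ℝ≥0∞ :=
  ⨆ ξ : F, ⨆ _ : ‖ξ‖ ≤ 1, ENNReal.ofReal (Real.sqrt
    (∑ i, ‖NormedSpace.fromTangentSpace (𝕜 := ℝ) (f z ξ)
      (mfderiv (𝓡 N) 𝓘(ℝ, G) (fun y => f y ξ) z
        (stdOrthonormalBasis ℝ (TangentSpace (𝓡 N) z) i))‖ ^ 2))

end Strong

/-! ### Hilbert bundles of bounded geometry -/

section HilbertBundle

/-- `T` is a unitary operator between Hilbert spaces. -/
def IsUnitaryMap {F G : Type*} [NormedAddCommGroup F] [InnerProductSpace ℂ F] [CompleteSpace F]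
    [NormedAddCommGroup G] [InnerProductSpace ℂ G] [CompleteSpace G] (T : F →L[ℂ] G) : Prop :=
  (ContinuousLinearMap.adjoint T).comp T = ContinuousLinearMap.id ℂ F ∧
    T.comp (ContinuousLinearMap.adjoint T) = ContinuousLinearMap.id ℂ G

variable [IsManifold (𝓡 N) ∞ M] [RiemannianBundle (fun x : M => TangentSpace (𝓡 N) x)]

/-- The space `Z`, the map `p : Z → M` and the maps `ψ x : p⁻¹(U_{x,r}) → U_{x,r} × F x` form a
Hilbert bundle of bounded geometry over `M`. The typical fibres `F x` of the trivializations are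
mutually isomorphic separable Hilbert spaces; they are all equal to one Hilbert space when
the family `F` is constant. -/
structure IsHilbertBundle (r : ℝ) {Z : Type*} [TopologicalSpace Z] (p : Z → M) (F : M → Type*)
    [∀ x, NormedAddCommGroup (F x)] [∀ x, InnerProductSpace ℂ (F x)] [∀ x, CompleteSpace (F x)]
    (ψ : ∀ x : M, p ⁻¹' normalBall (N := N) x r → normalBall (N := N) x r × F x) : Prop where
  boundedGeometryRadius : IsBoundedGeometryRadius N M r
  lt_injRadius : ∃ r' > r, IsInjRadius N M r'
  separable : ∀ x, SeparableSpace (F x)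
  fibers_iso : ∀ x y, Nonempty (F x ≃ₗᵢ[ℂ] F y)
  t2 : T2Space Z
  continuous : Continuous p
  surjective : Function.Surjective p
  homeo : ∀ x, IsHomeomorph (ψ x)
  fiber_preserving : ∀ x ξ, ((ψ x ξ).1 : M) = p ξ
  /-- The transition maps `τ x y = ψ x ∘ (ψ y)⁻¹` on `U_x ∩ U_y` are given by unitary operators, are
  strongly differentiable and have uniformly bounded strong derivatives. -/
  transition : ∃ τ : ∀ x y : M, M → (F y →L[ℂ] F x),
    (∀ x y, ∀ z ∈ normalBall (N := N) x r ∩ normalBall (N := N) y r, IsUnitaryMap (τ x y z)) ∧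
    (∀ x y (ξ : Z) (hx : p ξ ∈ normalBall (N := N) x r) (hy : p ξ ∈ normalBall (N := N) y r),
      (ψ x ⟨ξ, hx⟩).2 = τ x y (p ξ) (ψ y ⟨ξ, hy⟩).2) ∧
    (∀ x y, StronglyDiffOn N (τ x y) (normalBall (N := N) x r ∩ normalBall (N := N) y r)) ∧
    ⨆ x, ⨆ y, ⨆ z ∈ normalBall (N := N) x r ∩ normalBall (N := N) y r,
      strongDerivNorm N (τ x y) z < ⊤

end HilbertBundle

end Manifold

/-! ### Projections and the image bundle -/

section Projections

variable {H : Type*} [NormedAddCommGroup H] [InnerProductSpace ℂ H] [CompleteSpace H]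

variable (H) in
/-- The orthogonal projections in `L(H)`. -/
abbrev Projection : Type _ := {p : H →L[ℂ] H // IsStarProjection p}

/-- The image `pH`. -/
abbrev Projection.range (p : Projection H) : Submodule ℂ H := p.1.range

instance (p : Projection H) : CompleteSpace p.range := by
  have h : IsClosed (p.range : Set H) := by
    have : (p.range : Set H) = {v | p.1 v = v} := by
      ext v
      constructor
      · rintro ⟨w, rfl⟩
        exact congrArg (fun T : H →L[ℂ] H => T w) p.2.isIdempotentElem
      · intro hv
        exact ⟨v, hv⟩
    rw [this]
    exact isClosed_eq p.1.continuous continuous_id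
  exact h.completeSpace_coe

/-- The operator `p : H → pH`. -/
def Projection.toRange (p : Projection H) : H →L[ℂ] p.range :=
  p.1.codRestrict p.range (fun v => ⟨v, rfl⟩)

/-- The operator `pqp : pH → pH`. -/
def compression (p q : Projection H) : p.range →L[ℂ] p.range :=
  p.toRange.comp (q.1.comp p.range.subtypeL)

/-- The operator `T^{-1/2}` (for `T` positive and invertible), by the functional calculus in `L(K)`. -/
def invSqrt {K : Type*} [NormedAddCommGroup K] [InnerProductSpace ℂ K] [CompleteSpace K]
    (T : K →L[ℂ] K) : K →L[ℂ] K :=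
  T ^ (-(1 / 2) : ℝ)

/-- The operator `q (pqp)^{-1/2} : pH → qH`, where the power is taken in `L(pH)`. -/
def connector (p q : Projection H) : p.range →L[ℂ] q.range :=
  (q.toRange.comp p.range.subtypeL).comp (invSqrt (compression p q))

variable {M : Type*}

/-- The disjoint union of the spaces `P(x)H`, `x ∈ M`. -/
structure ImBundle (P : M → Projection H) where
  /-- the base point -/
  base : M
  /-- the vector in the fibre -/
  vec : (P base).range

variable {N : ℕ} [TopologicalSpace M] [ChartedSpace (EuclideanSpace ℝ (Fin N)) M]
  [IsManifold (𝓡 N) ∞ M] [RiemannianBundle (fun x : M => TangentSpace (𝓡 N) x)]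

variable (N) in
/-- The map `ψ_x : Im(P)|_{U_x} → U_x × P(x)H`, `ξ ↦ (y, W_x(y)^* ξ)` for `ξ ∈ P(y)H`, where
`W_x(y) = P(y) (P(x) P(y) P(x))^{-1/2}`. -/
def imTriv (P : M → Projection H) (r : ℝ) (x : M)
    (ξ : ImBundle.base (P := P) ⁻¹' normalBall (N := N) x r) :
    normalBall (N := N) x r × (P x).range :=
  (⟨ξ.1.base, ξ.2⟩, ContinuousLinearMap.adjoint (connector (P x) (P ξ.1.base)) ξ.1.vec)

variable (N) in
/-- The sets over some `U_x` whose image under `ψ_x` is open. -/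
def imBasis (P : M → Projection H) (r : ℝ) : Set (Set (ImBundle P)) :=
  {V | ∃ x : M, V ⊆ ImBundle.base ⁻¹' normalBall (N := N) x r ∧
    IsOpen (imTriv N P r x '' (Subtype.val ⁻¹' V))}

variable (N) in
/-- The topology on `Im(P)` generated by these sets. -/
abbrev imTopology (P : M → Projection H) (r : ℝ) : TopologicalSpace (ImBundle P) :=
  generateFrom (imBasis N P r)

variable (N) in
/-- The radius `r` is small enough for the construction of the local trivializations: `r < s`, where
`s` satisfies the bounded geometry conditions, and
`r < 1 / (4 · sup_{x ∈ M} ‖g_{φ_{x,s}}‖^{1/2} · sup_{x ∈ M} ‖dP(x)‖)`. Here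
`‖g_{φ_{x,s}}(exp_x v)‖^{1/2}` is the operator norm of the differential of `exp_x` at `v`. -/
def IsAdmissible (P : M → Projection H) (s r : ℝ) : Prop :=
  IsBoundedGeometryRadius N M s ∧ 0 < r ∧ r < s ∧
    4 * ENNReal.ofReal r *
      (⨆ x : M, ⨆ v ∈ Metric.ball (0 : TangentSpace (𝓡 N) x) s, ‖dexp x v‖ₑ) *
      (⨆ x : M, strongDerivNorm N (fun y => (P y).1) x) < 1

end Projections

end

-- Write `L` for the supremum of `‖dP‖` and `K` for that of `‖dexp‖` on balls of radius `s`. For `y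
-- = exp_x v` with `‖v‖ < r`, integrating the derivative of `t ↦ P (exp_x (t v)) ξ` over `[0, 1]`
-- gives `‖P x - P y‖ ≤ L K r`, and `4 r K L < 1` makes this at most `1/4`
-- (`IsAdmissible.norm_sub_le`). Everything else follows from this single estimate.
--
-- On `P(x)H` the compression `T = P(x)P(y)P(x)` then satisfies `‖1 - T‖ ≤ 1/4`. It is positive and
-- invertible, so `W = P(y) T^{-1/2}` has `W* W = T^{-1/2} T T^{-1/2} = 1`; the symmetric
-- invertibility of `P(y)P(x)P(y)` gives surjectivity (`isUnitaryMap_connector`). Moreover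
-- `T^{-1/2}` is the binomial series in `1 - T`, with a bound on its norm and on its derivative that
-- depends only on the radius `1/4` (`invSqrt_eq_tsum`, `StrongDirBound.tsum_smul_pow`).
--
-- Strong differentiability survives products and power series because a strongly `C¹` map is
-- locally Lipschitz in operator norm, by uniform boundedness (`StrongC1On.exists_lipschitz`). The
-- transition map is `W_x* W_y = T_x^{-1/2} · P(x)P(z)P(y) · T_y^{-1/2}`, so Leibniz' rule bounds
-- its derivative uniformly.
--
-- The topology is handled by comparison with `Im(P) ⊆ M × H`: each `ψ_x` is a homeomorphism for the
-- subspace topology, so the given sets form a basis of exactly that topology, and Hausdorffness and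
-- continuity of the projection are inherited.
--
-- One geometric point remains: `x` must lie in `U_x`, that is `exp_x 0 = x`. Since the exponential
-- map is defined by choosing a geodesic, this needs that a geodesic with zero initial velocity is
-- constant, which follows from conservation of energy.

noncomputable section

-- Calculus of strongly `C¹` operator-valued maps on a normed space.

section StrongCalculus

variable {E F G K : Type*} [NormedAddCommGroup E] [NormedSpace ℝ E]
  [NormedAddCommGroup F] [NormedSpace ℂ F] [NormedAddCommGroup G] [NormedSpace ℂ G]
  [NormedAddCommGroup K] [NormedSpace ℂ K]

/-- `z ↦ f z ξ` is `C¹` on `V` for every vector `ξ`. -/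
def StrongC1On (f : E → F →L[ℂ] G) (V : Set E) : Prop :=
  ∀ ξ : F, ContDiffOn ℝ 1 (fun z => f z ξ) V

/-- The strong derivative of `f` at `u` in the direction `a` has norm at most `b`. -/
def StrongDirBound (f : E → F →L[ℂ] G) (u a : E) (b : ℝ) : Prop :=
  ∀ ξ : F, ‖fderiv ℝ (fun z => f z ξ) u a‖ ≤ b * ‖ξ‖

theorem contDiffOn_one_of_hasFDerivAt {g : E → G} {g' : E → E →L[ℝ] G} {V : Set E} (hV : IsOpen V)
    (h : ∀ z ∈ V, HasFDerivAt g (g' z) z) (hc : ContinuousOn g' V) : ContDiffOn ℝ 1 g V := by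
  rw [show (1 : ℕ∞ω) = 0 + 1 from rfl, contDiffOn_succ_iff_fderiv_of_isOpen hV]
  refine ⟨fun z hz => (h z hz).differentiableAt.differentiableWithinAt, by simp, ?_⟩
  rw [contDiffOn_zero]
  exact hc.congr fun z hz => (h z hz).fderiv

theorem StrongC1On.differentiableAt {f : E → F →L[ℂ] G} {V : Set E} (hV : IsOpen V)
    (hf : StrongC1On f V) {u : E} (hu : u ∈ V) (ξ : F) :
    DifferentiableAt ℝ (fun z => f z ξ) u :=
  ((hf ξ).contDiffAt (hV.mem_nhds hu)).differentiableAt (by simp)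

/-- A strongly `C¹` map is locally Lipschitz for the operator norm (Banach–Steinhaus). -/
theorem StrongC1On.exists_lipschitz [FiniteDimensional ℝ E] [CompleteSpace F]
    {f : E → F →L[ℂ] G} {V : Set E} (hV : IsOpen V) (hf : StrongC1On f V) {u : E} (hu : u ∈ V) :
    ∃ C ≥ 0, ∃ ρ > 0, Metric.ball u ρ ⊆ V ∧
      ∀ z ∈ Metric.ball u ρ, ∀ z' ∈ Metric.ball u ρ, ‖f z - f z'‖ ≤ C * ‖z - z'‖ := by
  obtain ⟨ρ, hρ, hρV⟩ := Metric.nhds_basis_closedBall.mem_iff.1 (hV.mem_nhds hu)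
  have hsub := Metric.ball_subset_closedBall.trans hρV
  -- Banach–Steinhaus is applied to all difference quotients of `f` on the ball. On the diagonal the
  -- inverse of `0` is `0`, so those members vanish.
  let ι := {p : E × E // p.1 ∈ Metric.ball u ρ ∧ p.2 ∈ Metric.ball u ρ}
  let g : ι → F →L[ℂ] G := fun p => ((‖p.1.1 - p.1.2‖⁻¹ : ℝ) : ℂ) • (f p.1.1 - f p.1.2)
  obtain ⟨C, hC⟩ : ∃ C, ∀ i, ‖g i‖ ≤ C := by
    apply banach_steinhaus
    intro ξ
    have hcont : ContinuousOn (fderiv ℝ fun z => f z ξ) V :=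
      (hf ξ).continuousOn_fderiv_of_isOpen hV le_rfl
    obtain ⟨C, hC⟩ := (isCompact_closedBall u ρ).exists_bound_of_continuousOn (hcont.mono hρV)
    refine ⟨C, fun p => ?_⟩
    have h := (convex_ball u ρ).norm_image_sub_le_of_norm_fderiv_le (𝕜 := ℝ)
      (f := fun z => f z ξ) (C := C)
      (fun z hz => hf.differentiableAt hV (hsub hz) ξ)
      (fun z hz => hC z (Metric.ball_subset_closedBall hz)) p.2.2 p.2.1
    have hC0 : 0 ≤ C := (norm_nonneg _).trans (hC u (Metric.mem_closedBall_self hρ.le))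
    simp only [g, smul_apply, sub_apply, norm_smul,
      Complex.norm_real, norm_inv, norm_norm]
    rcases eq_or_ne p.1.1 p.1.2 with h0 | h0
    · simp [h0, hC0]
    · rw [inv_mul_le_iff₀ (norm_pos_iff.2 (sub_ne_zero.2 h0)), mul_comm]
      exact h
  refine ⟨max C 0, le_max_right _ _, ρ, hρ, hsub, fun z hz z' hz' => ?_⟩
  rcases eq_or_ne z z' with h0 | h0
  · simp [h0]
  · have h := hC ⟨(z, z'), hz, hz'⟩
    simp only [g, norm_smul, Complex.norm_real, norm_inv, norm_norm] at h
    rw [inv_mul_le_iff₀ (norm_pos_iff.2 (sub_ne_zero.2 h0)), mul_comm] at h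
    exact h.trans (mul_le_mul_of_nonneg_right (le_max_left _ _) (norm_nonneg _))

theorem StrongC1On.continuousOn [FiniteDimensional ℝ E] [CompleteSpace F]
    {f : E → F →L[ℂ] G} {V : Set E} (hV : IsOpen V) (hf : StrongC1On f V) : ContinuousOn f V := by
  intro u hu
  obtain ⟨C, hC, ρ, hρ, -, h⟩ := hf.exists_lipschitz hV hu
  have : LipschitzOnWith ⟨C, hC⟩ f (Metric.ball u ρ) :=
    LipschitzOnWith.of_dist_le_mul fun z hz z' hz' => by
      rw [dist_eq_norm, dist_eq_norm]; exact h z hz z' hz'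
  exact (this.continuousOn.continuousAt (Metric.ball_mem_nhds u hρ)).continuousWithinAt

theorem StrongC1On.exists_fderiv_le [FiniteDimensional ℝ E] [CompleteSpace F]
    {f : E → F →L[ℂ] G} {V : Set E} (hV : IsOpen V) (hf : StrongC1On f V) {u : E} (hu : u ∈ V) :
    ∃ C ≥ 0, ∃ ρ > 0, Metric.ball u ρ ⊆ V ∧
      ∀ z ∈ Metric.ball u ρ, ∀ ξ, ‖fderiv ℝ (fun z => f z ξ) z‖ ≤ C * ‖ξ‖ := by
  obtain ⟨C, hC, ρ, hρ, hsub, h⟩ := hf.exists_lipschitz hV hu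
  refine ⟨C, hC, ρ, hρ, hsub, fun z hz ξ => ?_⟩
  refine norm_fderiv_le_of_lip' ℝ (by positivity) ?_
  filter_upwards [Metric.isOpen_ball.mem_nhds hz] with z' hz'
  calc ‖f z' ξ - f z ξ‖ = ‖(f z' - f z) ξ‖ := rfl
    _ ≤ ‖f z' - f z‖ * ‖ξ‖ := ContinuousLinearMap.le_opNorm _ _
    _ ≤ C * ‖z' - z‖ * ‖ξ‖ := by gcongr; exact h z' hz' z hz
    _ = C * ‖ξ‖ * ‖z' - z‖ := by ring

/-- Up to a constant, `f z (v z)` is `f z (v u) + f u (v z) + (f z - f u) (v z - v u)`. The last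
term is quadratically small because `f` is Lipschitz in operator norm, so only the two Leibniz terms
survive. -/
theorem StrongC1On.hasFDerivAt_apply [FiniteDimensional ℝ E] [CompleteSpace F]
    {f : E → F →L[ℂ] G} {v : E → F} {V : Set E} (hV : IsOpen V) (hf : StrongC1On f V) {u : E}
    (hu : u ∈ V) (hv : DifferentiableAt ℝ v u) :
    HasFDerivAt (fun z => f z (v z)) (fderiv ℝ (fun z => f z (v u)) u +
      ((f u).restrictScalars ℝ).comp (fderiv ℝ v u)) u := by
  have h1 := (hf.differentiableAt hV hu (v u)).hasFDerivAt
  have h2 : HasFDerivAt (fun z => f u (v z)) (((f u).restrictScalars ℝ).comp (fderiv ℝ v u)) u :=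
    ((f u).restrictScalars ℝ).hasFDerivAt.comp u hv.hasFDerivAt
  have h3 : HasFDerivAt (fun z => (f z - f u) (v z - v u)) (0 : E →L[ℝ] G) u := by
    obtain ⟨C, hC, ρ, hρ, hsub, h⟩ := hf.exists_lipschitz hV hu
    obtain ⟨D, hD⟩ := hv.hasFDerivAt.isBigO_sub.bound
    apply HasFDerivAt.of_isLittleO
    have : (fun z => (f z - f u) (v z - v u)) =O[𝓝 u] fun z => ‖z - u‖ ^ 2 := by
      refine Asymptotics.IsBigO.of_bound (C * D) ?_
      filter_upwards [hD, Metric.ball_mem_nhds u hρ] with z hz hz'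
      calc ‖(f z - f u) (v z - v u)‖ ≤ ‖f z - f u‖ * ‖v z - v u‖ :=
            ContinuousLinearMap.le_opNorm _ _
        _ ≤ (C * ‖z - u‖) * (D * ‖z - u‖) := by
            gcongr
            exact h z hz' u (Metric.mem_ball_self hρ)
        _ = C * D * ‖‖z - u‖ ^ 2‖ := by rw [norm_pow, norm_norm]; ring
    have h4 : (fun z => ‖z - u‖ ^ 2) =o[𝓝 u] fun z => z - u :=
      Asymptotics.isLittleO_norm_pow_id (by norm_num) |>.comp_tendsto
        (by simpa using (continuous_sub_right u).tendsto u)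
    simpa using this.trans_isLittleO h4
  have := ((h1.add h2).add h3).sub_const (f u (v u))
  convert this using 1
  · ext z; simp; abel
  · simp

theorem StrongC1On.apply [FiniteDimensional ℝ E] [CompleteSpace F]
    {f : E → F →L[ℂ] G} {v : E → F} {V : Set E} (hV : IsOpen V) (hf : StrongC1On f V)
    (hv : ContDiffOn ℝ 1 v V) : ContDiffOn ℝ 1 (fun z => f z (v z)) V := by
  have hvd : ∀ z ∈ V, DifferentiableAt ℝ v z := fun z hz =>
    (hv.contDiffAt (hV.mem_nhds hz)).differentiableAt (by simp)
  refine contDiffOn_one_of_hasFDerivAt hV (fun z hz => hf.hasFDerivAt_apply hV hz (hvd z hz)) ?_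
  intro u hu
  have hvc : ContinuousAt v u := (hvd u hu).continuousAt
  refine (ContinuousAt.add ?_ ?_).continuousWithinAt
  · obtain ⟨C, hC, ρ, hρ, hsub, h⟩ := hf.exists_fderiv_le hV hu
    have hcont : ContinuousAt (fderiv ℝ fun z => f z (v u)) u :=
      ((hf (v u)).continuousOn_fderiv_of_isOpen hV le_rfl).continuousAt (hV.mem_nhds hu)
    -- The strong derivative is linear in the vector and bounded by `C` uniformly near `u`, so
    -- moving the vector from `v u` to `v z` costs at most `C * ‖v z - v u‖`.
    have key : Filter.Tendsto (fun z => fderiv ℝ (fun y => f y (v z)) z -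
        fderiv ℝ (fun y => f y (v u)) z) (𝓝 u) (𝓝 0) := by
      have hlim : Filter.Tendsto (fun z => C * ‖v z - v u‖) (𝓝 u) (𝓝 0) := by
        have := (hvc.sub (continuousAt_const (y := v u))).norm.const_mul C
        simpa [ContinuousAt] using this
      refine squeeze_zero_norm' ?_ hlim
      filter_upwards [Metric.ball_mem_nhds u hρ] with z hz
      rw [← fderiv_fun_sub (hf.differentiableAt hV (hsub hz) _)
        (hf.differentiableAt hV (hsub hz) _)]
      simpa using h z hz (v z - v u)
    have := key.add hcont
    simpa [ContinuousAt] using this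
  · have h1 : ContinuousAt f u := (hf.continuousOn hV).continuousAt (hV.mem_nhds hu)
    have h2 : ContinuousAt (fderiv ℝ v) u :=
      (hv.continuousOn_fderiv_of_isOpen hV le_rfl).continuousAt (hV.mem_nhds hu)
    have h3 : ContinuousAt (fun z => (f z).restrictScalars ℝ) u :=
      (ContinuousLinearMap.restrictScalarsL ℂ F G ℝ ℝ).continuous.continuousAt.comp h1
    exact h3.clm_comp h2

theorem StrongC1On.comp [FiniteDimensional ℝ E] [CompleteSpace G]
    {f : E → G →L[ℂ] K} {g : E → F →L[ℂ] G} {V : Set E} (hV : IsOpen V) (hf : StrongC1On f V)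
    (hg : StrongC1On g V) : StrongC1On (fun z => (f z).comp (g z)) V :=
  fun ξ => StrongC1On.apply (v := fun z => g z ξ) (f := f) hV hf (hg ξ)

theorem strongC1On_const (T : F →L[ℂ] G) (V : Set E) : StrongC1On (fun _ : E => T) V :=
  fun _ => contDiffOn_const

theorem strongDirBound_const (T : F →L[ℂ] G) (u a : E) : StrongDirBound (fun _ : E => T) u a 0 :=
  fun _ => by simp

theorem StrongDirBound.one_sub {T : E → F →L[ℂ] F} {u a : E} {b : ℝ}
    (hb : StrongDirBound T u a b) : StrongDirBound (fun z => 1 - T z) u a b := by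
  intro ξ
  have h := hb ξ
  simp only [sub_apply]
  rwa [fderiv_const_sub, neg_apply, norm_neg]

theorem StrongDirBound.comp [FiniteDimensional ℝ E] [CompleteSpace G]
    {f : E → G →L[ℂ] K} {g : E → F →L[ℂ] G} {V : Set E} (hV : IsOpen V) (hf : StrongC1On f V)
    (hg : StrongC1On g V) {u a : E} (hu : u ∈ V) {bf bg : ℝ} (hbf0 : 0 ≤ bf)
    (hbf : StrongDirBound f u a bf) (hbg : StrongDirBound g u a bg) :
    StrongDirBound (fun z => (f z).comp (g z)) u a (bf * ‖g u‖ + ‖f u‖ * bg) := by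
  intro ξ
  have h := (hf.hasFDerivAt_apply hV hu (hg.differentiableAt hV hu ξ)).fderiv
  simp only [ContinuousLinearMap.comp_apply, h]
  calc ‖(fderiv ℝ (fun z => f z (g u ξ)) u + ((f u).restrictScalars ℝ).comp
        (fderiv ℝ (fun z => g z ξ) u)) a‖
      ≤ ‖fderiv ℝ (fun z => f z (g u ξ)) u a‖ + ‖f u (fderiv ℝ (fun z => g z ξ) u a)‖ :=
        norm_add_le _ _
    _ ≤ bf * (‖g u‖ * ‖ξ‖) + ‖f u‖ * (bg * ‖ξ‖) := by
        refine add_le_add ((hbf _).trans ?_) ((ContinuousLinearMap.le_opNorm _ _).trans ?_)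
        · gcongr
          exact ContinuousLinearMap.le_opNorm _ _
        · gcongr
          exact hbg ξ
    _ = _ := by ring

theorem StrongC1On.pow [FiniteDimensional ℝ E] [CompleteSpace F]
    {A : E → F →L[ℂ] F} {V : Set E} (hV : IsOpen V) (hA : StrongC1On A V) (n : ℕ) :
    StrongC1On (fun z => A z ^ n) V := by
  induction n with
  | zero => simpa using strongC1On_const (1 : F →L[ℂ] F) V
  | succ n ih =>
    simp only [pow_succ']
    exact hA.comp hV ih

theorem ContinuousLinearMap.norm_pow_le_pow (T : F →L[ℂ] F) {q : ℝ} (hq : ‖T‖ ≤ q) (n : ℕ) :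
    ‖T ^ n‖ ≤ q ^ n := by
  have hq0 := (norm_nonneg _).trans hq
  induction n with
  | zero => rw [pow_zero, pow_zero]; exact ContinuousLinearMap.norm_id_le
  | succ n ih =>
    rw [pow_succ', pow_succ']
    exact (norm_mul_le _ _).trans (mul_le_mul hq ih (norm_nonneg _) hq0)

theorem StrongDirBound.pow [FiniteDimensional ℝ E] [CompleteSpace F]
    {A : E → F →L[ℂ] F} {V : Set E} (hV : IsOpen V) (hA : StrongC1On A V) {u a : E} (hu : u ∈ V)
    {b q : ℝ} (hb0 : 0 ≤ b) (hb : StrongDirBound A u a b) (hq : ‖A u‖ ≤ q) (n : ℕ) :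
    StrongDirBound (fun z => A z ^ n) u a (n * q ^ (n - 1) * b) := by
  have hq0 := (norm_nonneg _).trans hq
  induction n with
  | zero => simpa using strongDirBound_const (1 : F →L[ℂ] F) u a
  | succ n ih =>
    simp only [pow_succ']
    intro ξ
    refine (StrongDirBound.comp hV hA (hA.pow hV n) hu hb0 hb ih ξ).trans ?_
    gcongr
    calc b * ‖A u ^ n‖ + ‖A u‖ * (n * q ^ (n - 1) * b)
        ≤ b * q ^ n + q * (n * q ^ (n - 1) * b) := by
          gcongr
          exact ContinuousLinearMap.norm_pow_le_pow _ hq n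
      _ = ((n + 1 : ℕ) : ℝ) * q ^ (n + 1 - 1) * b := by
          -- The truncated exponent `n - 1` at `n = 0` is harmless, since its coefficient is `0`.
          rcases n with _ | n
          · simp
          · simp only [Nat.add_sub_cancel]; push_cast; ring

theorem summable_smul_pow [CompleteSpace F] {T : F →L[ℂ] F} {c : ℕ → ℝ} {q : ℝ}
    (hc : Summable fun n => |c n| * q ^ n) (hT : ‖T‖ ≤ q) :
    Summable fun n => (c n : ℂ) • T ^ n := by
  refine Summable.of_norm_bounded hc fun n => ?_
  rw [norm_smul, Complex.norm_real, Real.norm_eq_abs]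
  gcongr
  exact T.norm_pow_le_pow hT n

theorem hasSum_clm_apply {f : ℕ → F →L[ℂ] G} {S : F →L[ℂ] G} (h : HasSum f S) (ξ : F) :
    HasSum (fun n => f n ξ) (S ξ) :=
  h.mapL (ContinuousLinearMap.apply ℂ G ξ)

/-- Termwise differentiation: on a ball where the strong derivative of `A` is bounded by `C`, the
`n`-th term has derivative at most `|c n| n q^(n-1) C ‖ξ‖`, which is summable. The ball is chosen
before `ξ`. -/
theorem StrongC1On.hasFDerivAt_tsum [FiniteDimensional ℝ E] [CompleteSpace F]
    {A : E → F →L[ℂ] F} {V : Set E} (hV : IsOpen V) (hA : StrongC1On A V) {c : ℕ → ℝ} {q : ℝ}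
    (hq : ∀ z ∈ V, ‖A z‖ ≤ q) (hc : Summable fun n => |c n| * q ^ n)
    (hc' : Summable fun n => |c n| * (n * q ^ (n - 1))) {u : E} (hu : u ∈ V) :
    ∃ ρ > 0, Metric.ball u ρ ⊆ V ∧ ∀ ξ,
      (∀ z ∈ Metric.ball u ρ, HasFDerivAt (fun z => (∑' n, (c n : ℂ) • A z ^ n) ξ)
        (∑' n, fderiv ℝ (fun z => ((c n : ℂ) • A z ^ n) ξ) z) z) ∧
      ContinuousOn (fun z => ∑' n, fderiv ℝ (fun z => ((c n : ℂ) • A z ^ n) ξ) z)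
        (Metric.ball u ρ) ∧
      Summable fun n => fderiv ℝ (fun z => ((c n : ℂ) • A z ^ n) ξ) u := by
  obtain ⟨C, hC, ρ, hρ, hsub, h⟩ := hA.exists_fderiv_le hV hu
  have hq0 : 0 ≤ q := (norm_nonneg _).trans (hq u hu)
  refine ⟨ρ, hρ, hsub, fun ξ => ?_⟩
  have hsC1 : ∀ n, StrongC1On (fun z => (c n : ℂ) • A z ^ n) V := fun n η =>
    (hA.pow hV n η).const_smul (c n : ℂ)
  have hbound : ∀ n, ∀ z ∈ Metric.ball u ρ,
      ‖fderiv ℝ (fun z => ((c n : ℂ) • A z ^ n) ξ) z‖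
        ≤ |c n| * (n * q ^ (n - 1)) * (C * ‖ξ‖) := by
    intro n z hz
    refine ContinuousLinearMap.opNorm_le_bound _ (by positivity) fun a => ?_
    have hb : StrongDirBound A z a (C * ‖a‖) := fun η =>
      ((fderiv ℝ (fun z => A z η) z).le_opNorm a).trans
        ((mul_le_mul_of_nonneg_right (h z hz η) (norm_nonneg a)).trans_eq (by ring))
    have := hb.pow hV hA (hsub hz) (by positivity) (hq z (hsub hz)) n ξ
    simp only [smul_apply]
    rw [fderiv_fun_const_smul ((hA.pow hV n).differentiableAt hV (hsub hz) ξ)]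
    rw [smul_apply, norm_smul, Complex.norm_real, Real.norm_eq_abs]
    calc _ ≤ |c n| * (n * q ^ (n - 1) * (C * ‖a‖) * ‖ξ‖) := by gcongr
      _ = _ := by ring
  have hu' := hc'.mul_right (C * ‖ξ‖)
  refine ⟨?_, ?_, Summable.of_norm_bounded hu' fun n => hbound n u (Metric.mem_ball_self hρ)⟩
  · intro z hz
    have key : ∀ z ∈ Metric.ball u ρ, (∑' n, (c n : ℂ) • A z ^ n) ξ
        = ∑' n, ((c n : ℂ) • A z ^ n) ξ := fun z hz =>
      (hasSum_clm_apply (summable_smul_pow hc (hq z (hsub hz))).hasSum ξ).tsum_eq.symm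
    refine HasFDerivAt.congr_of_eventuallyEq (f := fun z => ∑' n, ((c n : ℂ) • A z ^ n) ξ) ?_
      (Filter.eventuallyEq_of_mem (Metric.isOpen_ball.mem_nhds hz) key)
    refine hasFDerivAt_tsum_of_isPreconnected hu' Metric.isOpen_ball
      (convex_ball u ρ).isPreconnected
      (fun n y hy => ((hsC1 n).differentiableAt hV (hsub hy) ξ).hasFDerivAt) hbound hz ?_ hz
    exact (hasSum_clm_apply (summable_smul_pow hc (hq z (hsub hz))).hasSum ξ).summable
  · exact continuousOn_tsum
      (fun n => ((hsC1 n ξ).continuousOn_fderiv_of_isOpen hV le_rfl).mono hsub) hu' hbound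

theorem StrongC1On.tsum_smul_pow [FiniteDimensional ℝ E] [CompleteSpace F]
    {A : E → F →L[ℂ] F} {V : Set E} (hV : IsOpen V) (hA : StrongC1On A V) {c : ℕ → ℝ} {q : ℝ}
    (hq : ∀ z ∈ V, ‖A z‖ ≤ q) (hc : Summable fun n => |c n| * q ^ n)
    (hc' : Summable fun n => |c n| * (n * q ^ (n - 1))) :
    StrongC1On (fun z => ∑' n, (c n : ℂ) • A z ^ n) V := by
  intro ξ u hu
  obtain ⟨ρ, hρ, -, h⟩ := hA.hasFDerivAt_tsum hV hq hc hc' hu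
  exact ((contDiffOn_one_of_hasFDerivAt Metric.isOpen_ball (h ξ).1 (h ξ).2.1).contDiffAt
    (Metric.ball_mem_nhds u hρ)).contDiffWithinAt

/-- The local constant of the differentiability proof is replaced by the bound `b` at `u` alone. The
resulting factor depends only on `c` and `q`, which is the source of uniformity over the manifold.
-/
theorem StrongDirBound.tsum_smul_pow [FiniteDimensional ℝ E] [CompleteSpace F]
    {A : E → F →L[ℂ] F} {V : Set E} (hV : IsOpen V) (hA : StrongC1On A V) {c : ℕ → ℝ} {q : ℝ}
    (hq : ∀ z ∈ V, ‖A z‖ ≤ q) (hc : Summable fun n => |c n| * q ^ n)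
    (hc' : Summable fun n => |c n| * (n * q ^ (n - 1))) {u a : E} (hu : u ∈ V) {b : ℝ}
    (hb0 : 0 ≤ b) (hb : StrongDirBound A u a b) :
    StrongDirBound (fun z => ∑' n, (c n : ℂ) • A z ^ n) u a
      ((∑' n, |c n| * (n * q ^ (n - 1))) * b) := by
  intro ξ
  obtain ⟨ρ, hρ, hsub, h⟩ := hA.hasFDerivAt_tsum hV hq hc hc' hu
  have hbound : ∀ n, ‖fderiv ℝ (fun z => ((c n : ℂ) • A z ^ n) ξ) u a‖
        ≤ |c n| * (n * q ^ (n - 1)) * (b * ‖ξ‖) := by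
    intro n
    simp only [smul_apply]
    rw [fderiv_fun_const_smul ((hA.pow hV n).differentiableAt hV hu ξ)]
    rw [smul_apply, norm_smul, Complex.norm_real, Real.norm_eq_abs]
    calc _ ≤ |c n| * (n * q ^ (n - 1) * b * ‖ξ‖) := by
          gcongr; exact hb.pow hV hA hu hb0 (hq u hu) n ξ
      _ = _ := by ring
  rw [((h ξ).1 u (Metric.mem_ball_self hρ)).fderiv]
  have h2 : HasSum (fun n => fderiv ℝ (fun z => ((c n : ℂ) • A z ^ n) ξ) u a) _ :=
    (h ξ).2.2.hasSum.mapL (ContinuousLinearMap.apply ℝ F a)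
  rw [mul_assoc, ← tsum_mul_right]
  exact h2.norm_le_of_bounded (hc'.mul_right (b * ‖ξ‖)).hasSum hbound

end StrongCalculus

-- The binomial series for `T^{-1/2}`.

section InverseSquareRoot

/-- The coefficients of the power series of `(1 - t)^{-1/2}`. -/
def invSqrtCoeff (n : ℕ) : ℝ := Ring.choose ((1 / 2 : ℝ) + n - 1) n

theorem hasSum_invSqrtCoeff {t : ℝ} (ht : |t| < 1) :
    HasSum (fun n => invSqrtCoeff n * t ^ n) ((1 - t) ^ (-(1 / 2) : ℝ)) := by
  have h := (Real.one_div_one_sub_rpow_hasFPowerSeriesOnBall_zero (1 / 2)).hasSum (y := t)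
    (by simpa [enorm_eq_nnnorm, ← NNReal.coe_lt_coe] using ht)
  simp only [FormalMultilinearSeries.ofScalars_apply_eq, smul_eq_mul, zero_add] at h
  rwa [Real.rpow_neg (by linarith [(abs_lt.1 ht).2]), ← one_div]

theorem exists_abs_invSqrtCoeff_le : ∃ C, ∀ n, |invSqrtCoeff n| ≤ C * 2 ^ n := by
  -- Convergence at `t = 1/2` already forces growth at most `2 ^ n`; at radius `1/4` this leaves a
  -- geometric series of ratio `1/2`.
  have h := (hasSum_invSqrtCoeff (t := 1 / 2) (by norm_num [abs_lt])).summable.tendsto_atTop_zero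
  obtain ⟨C, hC⟩ := (Metric.isBounded_range_of_tendsto _ h).exists_norm_le
  refine ⟨C, fun n => ?_⟩
  have := hC _ ⟨n, rfl⟩
  rw [norm_mul, Real.norm_eq_abs, norm_pow, Real.norm_of_nonneg (by norm_num), one_div, inv_pow,
    ← div_eq_mul_inv, div_le_iff₀ (by positivity)] at this
  exact this

theorem summable_abs_invSqrtCoeff : Summable fun n => |invSqrtCoeff n| * (1 / 4 : ℝ) ^ n := by
  obtain ⟨C, hC⟩ := exists_abs_invSqrtCoeff_le
  refine Summable.of_nonneg_of_le (fun n => by positivity) (fun n => ?_)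
    (summable_geometric_two.mul_left C)
  calc |invSqrtCoeff n| * (1 / 4 : ℝ) ^ n ≤ C * 2 ^ n * (1 / 4 : ℝ) ^ n := by
        gcongr; exact hC n
    _ = C * (1 / 2) ^ n := by rw [mul_assoc, ← mul_pow]; norm_num

theorem summable_abs_invSqrtCoeff_deriv :
    Summable fun n : ℕ => |invSqrtCoeff n| * (n * (1 / 4 : ℝ) ^ (n - 1)) := by
  obtain ⟨C, hC⟩ := exists_abs_invSqrtCoeff_le
  have hs := summable_pow_mul_geometric_of_norm_lt_one 1 (r := (1 / 2 : ℝ)) (by norm_num)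
  refine Summable.of_nonneg_of_le (fun n => by positivity) (fun n => ?_) (hs.mul_left (4 * C))
  rcases n with _ | n
  · simp
  · calc |invSqrtCoeff (n + 1)| * ((n + 1 : ℕ) * (1 / 4 : ℝ) ^ (n + 1 - 1))
        ≤ C * 2 ^ (n + 1) * ((n + 1 : ℕ) * (1 / 4 : ℝ) ^ (n + 1 - 1)) := by
          gcongr; exact hC _
      _ = 2 * C * (n + 1 : ℕ) * (2 ^ n * (1 / 4) ^ n) := by
          rw [Nat.add_sub_cancel, pow_succ]; ring
      _ = 4 * C * ((n + 1 : ℕ) ^ 1 * (1 / 2) ^ (n + 1)) := by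
          rw [← mul_pow]; norm_num [pow_succ]; ring

variable {K : Type*} [NormedAddCommGroup K] [InnerProductSpace ℂ K] [CompleteSpace K]

/-- The partial sums are polynomials in `A = 1 - T`, hence values of the functional calculus of `A`.
They converge uniformly to `(1 - t)^{-1/2}` on the spectrum, which lies in `[-1/4, 1/4]`. -/
theorem invSqrt_eq_tsum {T : K →L[ℂ] K} (hT0 : IsSelfAdjoint T) (hT : ‖1 - T‖ ≤ 1 / 4) :
    invSqrt T = ∑' n, (invSqrtCoeff n : ℂ) • (1 - T) ^ n := by
  set A : K →L[ℂ] K := 1 - T with hA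
  have hAs : IsSelfAdjoint A := (IsSelfAdjoint.one _).sub hT0
  have hspec : ∀ t ∈ spectrum ℝ A, |t| ≤ 1 / 4 := fun t ht => by
    refine (spectrum.norm_le_norm_mul_of_mem ht).trans ?_
    -- Only an inequality, as the identity has norm `0` when `K` is trivial.
    have h1 : ‖(1 : K →L[ℂ] K)‖ ≤ 1 := ContinuousLinearMap.norm_id_le
    nlinarith [norm_nonneg A, norm_nonneg (1 : K →L[ℂ] K)]
  have h1 : invSqrt T = cfc (fun t : ℝ => (1 - t) ^ (-(1 / 2) : ℝ)) A := by
    rw [← CFC.cfc_rpow (fun t ht => by linarith [(abs_le.1 (hspec t ht)).2])]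
    rw [cfc_sub (fun _ => 1) (fun t => t) A, cfc_const_one ℝ A, cfc_id' ℝ A, hA, sub_sub_cancel]
    rfl
  have h2 : ∀ m : ℕ, ∑ n ∈ Finset.range m, (invSqrtCoeff n : ℂ) • A ^ n
      = cfc (fun t : ℝ => ∑ n ∈ Finset.range m, invSqrtCoeff n * t ^ n) A := by
    intro m
    rw [← Finset.sum_fn, cfc_sum (fun n (t : ℝ) => invSqrtCoeff n * t ^ n) A]
    refine Finset.sum_congr rfl fun n _ => ?_
    rw [cfc_const_mul (invSqrtCoeff n) (fun t => t ^ n) A, cfc_pow_id A n, Complex.coe_smul]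
  have h3 := (summable_smul_pow (T := A) summable_abs_invSqrtCoeff hT).hasSum.tendsto_sum_nat
  have h4 : Filter.Tendsto (fun m => cfc (fun t : ℝ => ∑ n ∈ Finset.range m,
      invSqrtCoeff n * t ^ n) A) Filter.atTop (𝓝 (invSqrt T)) := by
    rw [h1]
    refine tendsto_cfc_fun ?_ (Filter.Eventually.of_forall fun m => by fun_prop)
    have h5 := tendstoUniformlyOn_tsum_nat (f := fun n (t : ℝ) => invSqrtCoeff n * t ^ n)
      (s := spectrum ℝ A) summable_abs_invSqrtCoeff (fun n t ht => by
        rw [norm_mul, norm_pow, Real.norm_eq_abs, Real.norm_eq_abs]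
        gcongr
        exact hspec t ht)
    refine h5.congr_right fun t ht => ?_
    exact (hasSum_invSqrtCoeff ((hspec t ht).trans_lt (by norm_num))).tsum_eq
  simp only [h2] at h3
  exact tendsto_nhds_unique h4 h3

theorem isSelfAdjoint_invSqrt (T : K →L[ℂ] K) : IsSelfAdjoint (invSqrt T) :=
  IsSelfAdjoint.of_nonneg CFC.rpow_nonneg

theorem invSqrt_mul_mul_invSqrt {T : K →L[ℂ] K} (h0 : 0 ≤ T) (hT : IsUnit T) :
    invSqrt T * T * invSqrt T = 1 := by
  have h := CFC.rpow_one T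
  unfold invSqrt
  nth_rewrite 2 [← h]
  rw [← CFC.rpow_add hT, ← CFC.rpow_add hT]
  norm_num
  exact CFC.rpow_zero T

theorem isUnit_of_norm_one_sub_lt_one {T : K →L[ℂ] K} (h : ‖1 - T‖ < 1) : IsUnit T := by
  have := isUnit_one_sub_of_norm_lt_one h
  rwa [sub_sub_cancel] at this

theorem exists_invSqrt_mul_eq_one {T : K →L[ℂ] K} (h0 : 0 ≤ T) (hT : IsUnit T) :
    ∃ S, invSqrt T * S = 1 := by
  refine ⟨T ^ (1 / 2 : ℝ), ?_⟩
  unfold invSqrt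
  rw [← CFC.rpow_add hT]
  norm_num
  exact CFC.rpow_zero T

end InverseSquareRoot

-- The unitary between the images of two nearby projections.

section Connector

variable {H : Type*} [NormedAddCommGroup H] [InnerProductSpace ℂ H] [CompleteSpace H]

theorem Projection.apply_of_mem (p : Projection H) {v : H} (hv : v ∈ p.range) : p.1 v = v := by
  obtain ⟨w, rfl⟩ := hv
  exact congrArg (fun T : H →L[ℂ] H => T w) p.2.isIdempotentElem

theorem Projection.inner_left (p : Projection H) (v w : H) : inner ℂ (p.1 v) w = inner ℂ v (p.1 w) :=
  (ContinuousLinearMap.isSelfAdjoint_iff_isSymmetric.1 p.2.isSelfAdjoint) v w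

theorem Projection.adjoint_subtypeL (p : Projection H) :
    ContinuousLinearMap.adjoint p.range.subtypeL = p.toRange := by
  symm
  rw [ContinuousLinearMap.eq_adjoint_iff]
  intro v w
  change inner ℂ (p.1 v) (w : H) = inner ℂ v (w : H)
  rw [p.inner_left, p.apply_of_mem w.2]

theorem Projection.adjoint_toRange (p : Projection H) :
    ContinuousLinearMap.adjoint p.toRange = p.range.subtypeL := by
  rw [← p.adjoint_subtypeL, ContinuousLinearMap.adjoint_adjoint]

theorem Projection.norm_apply_le (p : Projection H) (v : H) : ‖p.1 v‖ ≤ ‖v‖ :=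
  (p.1.le_opNorm v).trans (mul_le_of_le_one_left (norm_nonneg v) p.2.norm_le)

theorem Projection.norm_toRange_le (p : Projection H) : ‖p.toRange‖ ≤ 1 :=
  ContinuousLinearMap.opNorm_le_bound _ zero_le_one fun v => by
    rw [one_mul]; exact p.norm_apply_le v

theorem Projection.norm_subtypeL_le (p : Projection H) : ‖p.range.subtypeL‖ ≤ 1 :=
  ContinuousLinearMap.opNorm_le_bound _ zero_le_one fun v => by rw [one_mul]; rfl

theorem compression_nonneg (p q : Projection H) : 0 ≤ compression p q := by
  rw [ContinuousLinearMap.nonneg_iff_isPositive]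
  have hq : q.1.IsPositive := (ContinuousLinearMap.nonneg_iff_isPositive _).1 q.2.nonneg
  have := hq.adjoint_conj p.range.subtypeL
  rwa [p.adjoint_subtypeL] at this

/-- On `pH` the identity is the compression of `p` itself, so the difference is the compression of
`p - q`. -/
theorem norm_one_sub_compression_le (p q : Projection H) :
    ‖1 - compression p q‖ ≤ ‖p.1 - q.1‖ := by
  have : 1 - compression p q = p.toRange.comp ((p.1 - q.1).comp p.range.subtypeL) := by
    ext v
    change (v : H) - p.1 (q.1 v) = p.1 (p.1 v - q.1 v)
    rw [map_sub, p.apply_of_mem v.2, p.apply_of_mem v.2]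
  rw [this]
  calc _ ≤ ‖p.toRange‖ * (‖p.1 - q.1‖ * ‖p.range.subtypeL‖) :=
        (ContinuousLinearMap.opNorm_comp_le _ _).trans
          (mul_le_mul_of_nonneg_left (ContinuousLinearMap.opNorm_comp_le _ _) (norm_nonneg _))
    _ ≤ 1 * (‖p.1 - q.1‖ * 1) := by
        gcongr
        · exact p.norm_toRange_le
        · exact p.norm_subtypeL_le
    _ = _ := by ring

theorem isUnit_compression {p q : Projection H} (h : ‖p.1 - q.1‖ < 1) :
    IsUnit (compression p q) :=
  isUnit_of_norm_one_sub_lt_one ((norm_one_sub_compression_le p q).trans_lt h)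

theorem adjoint_connector (p q : Projection H) : ContinuousLinearMap.adjoint (connector p q)
    = (invSqrt (compression p q)).comp (p.toRange.comp q.range.subtypeL) := by
  unfold connector
  rw [ContinuousLinearMap.adjoint_comp, ContinuousLinearMap.adjoint_comp, p.adjoint_subtypeL,
    q.adjoint_toRange, (isSelfAdjoint_invSqrt _).adjoint_eq]

theorem isUnitaryMap_connector {p q : Projection H} (h : ‖p.1 - q.1‖ < 1) :
    IsUnitaryMap (connector p q) := by
  have hu := isUnit_compression h
  have h1 : (ContinuousLinearMap.adjoint (connector p q)).comp (connector p q)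
      = ContinuousLinearMap.id ℂ p.range := by
    rw [adjoint_connector, ← ContinuousLinearMap.one_def,
      ← invSqrt_mul_mul_invSqrt (compression_nonneg p q) hu]
    rfl
  refine ⟨h1, ?_⟩
  have hu' : IsUnit (compression q p) := isUnit_compression (by rwa [norm_sub_rev])
  obtain ⟨S, h3⟩ := exists_invSqrt_mul_eq_one (compression_nonneg p q) hu
  -- With `S` a right inverse of `(pqp)^{-1/2}`, the operator `qpq` on `qH` factors through `W`. As
  -- `W W* W = W`, the projection `W W*` fixes its range; `qpq` being invertible, `W W* = 1`.
  have h2 : compression q p = (connector p q).comp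
      (S.comp (p.toRange.comp q.range.subtypeL)) := by
    ext v
    have h4 := congrArg (fun S : p.range →L[ℂ] p.range => ((q.1 (S (p.toRange v)) : H))) h3
    exact h4.symm
  obtain ⟨U, hU⟩ := hu'
  set W := connector p q
  set X := S.comp (p.toRange.comp q.range.subtypeL)
  have h5 : (W.comp (ContinuousLinearMap.adjoint W)) * (U : q.range →L[ℂ] q.range) = U := by
    rw [hU, h2]
    calc (W.comp (ContinuousLinearMap.adjoint W)) * (W.comp X)
        = W.comp (((ContinuousLinearMap.adjoint W).comp W).comp X) := rfl
      _ = W.comp X := by rw [h1, ContinuousLinearMap.id_comp]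
  exact U.isUnit.mul_right_cancel (by rw [h5]; exact (one_mul _).symm)

end Connector

-- Strong derivatives on the manifold, read in charts.

section ManifoldStrong

set_option linter.unusedSectionVars false

variable {N : ℕ} {M : Type*} [TopologicalSpace M] [ChartedSpace (EuclideanSpace ℝ (Fin N)) M]
  {F G K : Type*} [NormedAddCommGroup F] [InnerProductSpace ℂ F]
  [NormedAddCommGroup G] [InnerProductSpace ℂ G] [NormedAddCommGroup K] [InnerProductSpace ℂ K]

variable (N) in
/-- The part of the coordinate domain of the chart at `z` which corresponds to `U`. -/
def chartSet (z : M) (U : Set M) : Set (EuclideanSpace ℝ (Fin N)) :=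
  (extChartAt (𝓡 N) z).target ∩ (extChartAt (𝓡 N) z).symm ⁻¹' U

theorem isOpen_chartSet (z : M) {U : Set M} (hU : IsOpen U) : IsOpen (chartSet N z U) :=
  (continuousOn_extChartAt_symm z).isOpen_inter_preimage (isOpen_extChartAt_target z) hU

theorem mem_chartSet {z : M} {U : Set M} (hz : z ∈ U) : extChartAt (𝓡 N) z z ∈ chartSet N z U :=
  ⟨mem_extChartAt_target z, by simpa using hz⟩

variable [IsManifold (𝓡 N) ∞ M]

theorem ContMDiffOn.comp_extChartAt_symm {E' : Type*} [NormedAddCommGroup E'] [NormedSpace ℝ E']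
    {g : M → E'} {U : Set M} (hg : ContMDiffOn (𝓡 N) 𝓘(ℝ, E') 1 g U) (z : M) :
    ContDiffOn ℝ 1 (fun u => g ((extChartAt (𝓡 N) z).symm u)) (chartSet N z U) := by
  rw [← contMDiffOn_iff_contDiffOn]
  have h : ContMDiffOn 𝓘(ℝ, EuclideanSpace ℝ (Fin N)) (𝓡 N) 1 (extChartAt (𝓡 N) z).symm
      (extChartAt (𝓡 N) z).target := by
    have := contMDiffOn_extChartAt_symm (I := 𝓡 N) (n := ∞) z
    exact this.of_le (by norm_cast)
  exact hg.comp (h.mono inter_subset_left) fun u hu => hu.2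

theorem contMDiffAt_of_contDiffOn_chartSet {E' : Type*} [NormedAddCommGroup E'] [NormedSpace ℝ E']
    {g : M → E'} {U : Set M} (hU : IsOpen U) {z : M} (hz : z ∈ U)
    (hg : ContDiffOn ℝ 1 (fun u => g ((extChartAt (𝓡 N) z).symm u)) (chartSet N z U)) :
    ContMDiffAt (𝓡 N) 𝓘(ℝ, E') 1 g z := by
  have h1 := (hg.contDiffAt ((isOpen_chartSet z hU).mem_nhds (mem_chartSet hz))).contMDiffAt
  have h2 : ContMDiffAt (𝓡 N) 𝓘(ℝ, EuclideanSpace ℝ (Fin N)) 1 (extChartAt (𝓡 N) z) z :=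
    (contMDiffAt_extChartAt (I := 𝓡 N) (n := ∞)).of_le (by norm_cast)
  refine (h1.comp z h2).congr_of_eventuallyEq ?_
  filter_upwards [extChartAt_source_mem_nhds (I := 𝓡 N) z] with y hy
  exact congrArg g ((extChartAt (𝓡 N) z).left_inv hy).symm

/-- The tangent space at `z` is identified with the model space through the preferred chart at `z`,
so in that chart no change-of-coordinates factor appears. -/
theorem fromTangentSpace_mfderiv {E' : Type*} [NormedAddCommGroup E'] [NormedSpace ℝ E']
    {g : M → E'} {z : M} (hg : MDifferentiableAt (𝓡 N) 𝓘(ℝ, E') g z) (w : TangentSpace (𝓡 N) z) :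
    NormedSpace.fromTangentSpace (𝕜 := ℝ) (g z) (mfderiv (𝓡 N) 𝓘(ℝ, E') g z w)
      = fderiv ℝ (fun u => g ((extChartAt (𝓡 N) z).symm u)) (extChartAt (𝓡 N) z z) w := by
  rw [hg.mfderiv]
  simp only [writtenInExtChartAt, extChartAt_model_space_eq_id, modelWithCornersSelf_coe, range_id,
    fderivWithin_univ]
  rfl

theorem StronglyDiffOn.strongC1On {f : M → F →L[ℂ] G} {U : Set M} (hf : StronglyDiffOn N f U)
    (z : M) : StrongC1On (fun u => f ((extChartAt (𝓡 N) z).symm u)) (chartSet N z U) :=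
  fun ξ => (hf ξ).comp_extChartAt_symm z

theorem stronglyDiffOn_of_strongC1On {f : M → F →L[ℂ] G} {U : Set M} (hU : IsOpen U)
    (hf : ∀ z ∈ U, StrongC1On (fun u => f ((extChartAt (𝓡 N) z).symm u)) (chartSet N z U)) :
    StronglyDiffOn N f U :=
  fun ξ z hz => (contMDiffAt_of_contDiffOn_chartSet hU hz (hf z hz ξ)).contMDiffWithinAt

theorem StronglyDiffOn.mdifferentiableAt {f : M → F →L[ℂ] G} {U : Set M} (hU : IsOpen U)
    (hf : StronglyDiffOn N f U) {z : M} (hz : z ∈ U) (ξ : F) :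
    MDifferentiableAt (𝓡 N) 𝓘(ℝ, G) (fun y => f y ξ) z :=
  ((hf ξ).contMDiffAt (hU.mem_nhds hz)).mdifferentiableAt (by simp)

theorem StronglyDiffOn.continuousOn [CompleteSpace F] {f : M → F →L[ℂ] G} {U : Set M}
    (hU : IsOpen U) (hf : StronglyDiffOn N f U) : ContinuousOn f U := by
  intro z hz
  have h1 := ((hf.strongC1On z).continuousOn (isOpen_chartSet z hU)).continuousAt
    ((isOpen_chartSet z hU).mem_nhds (mem_chartSet hz))
  have h2 := ContinuousAt.comp (f := extChartAt (𝓡 N) z) (x := z) h1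
    (continuousAt_extChartAt (I := 𝓡 N) z)
  refine (h2.congr ?_).continuousWithinAt
  filter_upwards [extChartAt_source_mem_nhds (I := 𝓡 N) z] with y hy
  exact congrArg f ((extChartAt (𝓡 N) z).left_inv hy)

theorem stronglyDiffOn_const (T : F →L[ℂ] G) (U : Set M) : StronglyDiffOn N (fun _ : M => T) U :=
  fun _ => contMDiffOn_const

theorem StronglyDiffOn.mono {f : M → F →L[ℂ] G} {U V : Set M} (hf : StronglyDiffOn N f U)
    (h : V ⊆ U) : StronglyDiffOn N f V := fun ξ => (hf ξ).mono h

theorem StronglyDiffOn.comp [CompleteSpace G] {f : M → G →L[ℂ] K} {g : M → F →L[ℂ] G} {U : Set M}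
    (hU : IsOpen U) (hf : StronglyDiffOn N f U) (hg : StronglyDiffOn N g U) :
    StronglyDiffOn N (fun z => (f z).comp (g z)) U :=
  stronglyDiffOn_of_strongC1On hU fun z _ =>
    (hf.strongC1On z).comp (isOpen_chartSet z hU) (hg.strongC1On z)

theorem StronglyDiffOn.congr {f g : M → F →L[ℂ] G} {U : Set M} (hf : StronglyDiffOn N f U)
    (h : ∀ z ∈ U, g z = f z) : StronglyDiffOn N g U :=
  fun ξ => (hf ξ).congr fun z hz => by rw [h z hz]

/-- The strong derivative of `f` at `z` in the direction `w` has norm at most `b`. -/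
def StrongMDirBound (f : M → F →L[ℂ] G) (z : M) (w : TangentSpace (𝓡 N) z) (b : ℝ) : Prop :=
  ∀ ξ : F, ‖NormedSpace.fromTangentSpace (𝕜 := ℝ) (f z ξ)
    (mfderiv (𝓡 N) 𝓘(ℝ, G) (fun y => f y ξ) z w)‖ ≤ b * ‖ξ‖

theorem strongMDirBound_iff {f : M → F →L[ℂ] G} {U : Set M} (hU : IsOpen U)
    (hf : StronglyDiffOn N f U) {z : M} (hz : z ∈ U) (w : TangentSpace (𝓡 N) z) (b : ℝ) :
    StrongMDirBound f z w b ↔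
      StrongDirBound (fun u => f ((extChartAt (𝓡 N) z).symm u)) (extChartAt (𝓡 N) z z) w b :=
  forall_congr' fun ξ => by rw [fromTangentSpace_mfderiv (hf.mdifferentiableAt hU hz ξ)]

theorem strongMDirBound_const (T : F →L[ℂ] G) (z : M) (w : TangentSpace (𝓡 N) z) :
    StrongMDirBound (fun _ : M => T) z w 0 :=
  fun _ => by simp [mfderiv_const]

theorem StrongMDirBound.congr {f g : M → F →L[ℂ] G} {z : M} {w : TangentSpace (𝓡 N) z} {b : ℝ}
    (hf : StrongMDirBound f z w b) {U : Set M} (hU : IsOpen U) (hz : z ∈ U)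
    (h : ∀ y ∈ U, g y = f y) : StrongMDirBound g z w b := by
  intro ξ
  have h1 : (fun y => g y ξ) =ᶠ[𝓝 z] fun y => f y ξ := by
    filter_upwards [hU.mem_nhds hz] with y hy
    rw [h y hy]
  have := h1.mfderiv_eq (I := 𝓡 N) (I' := 𝓘(ℝ, G))
  exact (congrArg (fun T : EuclideanSpace ℝ (Fin N) →L[ℝ] G => ‖T w‖) this).le.trans (hf ξ)

theorem StrongMDirBound.comp [CompleteSpace G] {f : M → G →L[ℂ] K} {g : M → F →L[ℂ] G} {U : Set M}
    (hU : IsOpen U) (hf : StronglyDiffOn N f U) (hg : StronglyDiffOn N g U) {z : M} (hz : z ∈ U)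
    {w : TangentSpace (𝓡 N) z} {bf bg : ℝ} (hbf0 : 0 ≤ bf)
    (hbf : StrongMDirBound f z w bf) (hbg : StrongMDirBound g z w bg) :
    StrongMDirBound (fun z => (f z).comp (g z)) z w (bf * ‖g z‖ + ‖f z‖ * bg) := by
  rw [strongMDirBound_iff hU hf hz] at hbf
  rw [strongMDirBound_iff hU hg hz] at hbg
  rw [strongMDirBound_iff hU (hf.comp hU hg) hz]
  have := StrongDirBound.comp (isOpen_chartSet z hU) (hf.strongC1On z) (hg.strongC1On z)
    (mem_chartSet hz) hbf0 hbf hbg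
  simpa using this

theorem StrongMDirBound.mono {f : M → F →L[ℂ] G} {z : M} {w : TangentSpace (𝓡 N) z} {b b' : ℝ}
    (hf : StrongMDirBound f z w b) (h : b ≤ b') : StrongMDirBound f z w b' :=
  fun ξ => (hf ξ).trans (by gcongr)

/-- A bound for the derivative of `T ↦ T^{-1/2}` on the ball of radius `1/4` around `1`. -/
def invSqrtDerivBound : ℝ := ∑' n : ℕ, |invSqrtCoeff n| * (n * (1 / 4 : ℝ) ^ (n - 1))

theorem invSqrtDerivBound_nonneg : 0 ≤ invSqrtDerivBound := tsum_nonneg fun n => by positivity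

/-- A bound for the norm of `T^{-1/2}` on the ball of radius `1/4` around `1`. -/
def invSqrtBound : ℝ := ∑' n : ℕ, |invSqrtCoeff n| * (1 / 4 : ℝ) ^ n

theorem invSqrtBound_nonneg : 0 ≤ invSqrtBound := tsum_nonneg fun n => by positivity

theorem norm_invSqrt_le [CompleteSpace F] {T : F →L[ℂ] F} (hT0 : IsSelfAdjoint T)
    (hT : ‖1 - T‖ ≤ 1 / 4) : ‖invSqrt T‖ ≤ invSqrtBound := by
  rw [invSqrt_eq_tsum hT0 hT]
  refine tsum_of_norm_bounded summable_abs_invSqrtCoeff.hasSum fun n => ?_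
  rw [norm_smul, Complex.norm_real, Real.norm_eq_abs]
  gcongr
  exact ContinuousLinearMap.norm_pow_le_pow _ hT n

theorem StronglyDiffOn.invSqrt [CompleteSpace F] {T : M → F →L[ℂ] F} {U : Set M} (hU : IsOpen U)
    (hA : StronglyDiffOn N (fun z => 1 - T z) U) (hs : ∀ z ∈ U, IsSelfAdjoint (T z))
    (hT : ∀ z ∈ U, ‖1 - T z‖ ≤ 1 / 4) : StronglyDiffOn N (fun z => _root_.invSqrt (T z)) U := by
  refine StronglyDiffOn.congr (f := fun z => ∑' n, (invSqrtCoeff n : ℂ) • (1 - T z) ^ n) ?_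
    fun z hz => invSqrt_eq_tsum (hs z hz) (hT z hz)
  exact stronglyDiffOn_of_strongC1On hU fun z _ =>
    (hA.strongC1On z).tsum_smul_pow (isOpen_chartSet z hU) (fun u hu => hT _ hu.2)
      summable_abs_invSqrtCoeff summable_abs_invSqrtCoeff_deriv

theorem StrongMDirBound.invSqrt [CompleteSpace F] {T : M → F →L[ℂ] F} {U : Set M} (hU : IsOpen U)
    (hA : StronglyDiffOn N (fun z => 1 - T z) U) (hs : ∀ z ∈ U, IsSelfAdjoint (T z))
    (hT : ∀ z ∈ U, ‖1 - T z‖ ≤ 1 / 4) {z : M} (hz : z ∈ U) {w : TangentSpace (𝓡 N) z} {b : ℝ}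
    (hb0 : 0 ≤ b) (hb : StrongMDirBound (fun z => 1 - T z) z w b) :
    StrongMDirBound (fun z => _root_.invSqrt (T z)) z w (invSqrtDerivBound * b) := by
  have heq : ∀ z ∈ U, _root_.invSqrt (T z) = ∑' n, (invSqrtCoeff n : ℂ) • (1 - T z) ^ n :=
    fun z hz => invSqrt_eq_tsum (hs z hz) (hT z hz)
  refine StrongMDirBound.congr (f := fun z => ∑' n, (invSqrtCoeff n : ℂ) • (1 - T z) ^ n) ?_
    hU hz heq
  have hf : StronglyDiffOn N (fun z => ∑' n, (invSqrtCoeff n : ℂ) • (1 - T z) ^ n) U :=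
    (StronglyDiffOn.invSqrt hU hA hs hT).congr fun z hz => (heq z hz).symm
  rw [strongMDirBound_iff hU hf hz]
  rw [strongMDirBound_iff hU hA hz] at hb
  exact StrongDirBound.tsum_smul_pow (isOpen_chartSet z hU) (hA.strongC1On z)
    (fun u hu => hT _ hu.2) summable_abs_invSqrtCoeff summable_abs_invSqrtCoeff_deriv
    (mem_chartSet hz) hb0 hb

theorem StronglyDiffOn.one_sub {T : M → F →L[ℂ] F} {U : Set M} (hT : StronglyDiffOn N T U) :
    StronglyDiffOn N (fun z => 1 - T z) U :=
  fun ξ => (contMDiffOn_const (c := ξ)).sub (hT ξ)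

theorem StrongMDirBound.one_sub {T : M → F →L[ℂ] F} {U : Set M} (hU : IsOpen U)
    (hT : StronglyDiffOn N T U) {z : M} (hz : z ∈ U) {w : TangentSpace (𝓡 N) z} {b : ℝ}
    (hb : StrongMDirBound T z w b) : StrongMDirBound (fun z => 1 - T z) z w b := by
  rw [strongMDirBound_iff hU hT.one_sub hz]
  rw [strongMDirBound_iff hU hT hz] at hb
  exact hb.one_sub

variable [RiemannianBundle (fun x : M => TangentSpace (𝓡 N) x)]

/-- The norm is of Hilbert–Schmidt type in the tangent variable: each of the `N` orthonormal
directions contributes at most `b ^ 2`, whence `√N`. -/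
theorem strongDerivNorm_le {f : M → F →L[ℂ] G} {z : M} {b : ℝ} (hb0 : 0 ≤ b)
    (hb : ∀ w : TangentSpace (𝓡 N) z, StrongMDirBound f z w (b * ‖w‖)) :
    strongDerivNorm N f z ≤ ENNReal.ofReal (Real.sqrt N * b) := by
  refine iSup₂_le fun ξ hξ => ENNReal.ofReal_le_ofReal ?_
  rw [Real.sqrt_le_left (by positivity), mul_pow, Real.sq_sqrt (Nat.cast_nonneg N)]
  have hfin : Module.finrank ℝ (TangentSpace (𝓡 N) z) = N :=
    finrank_euclideanSpace_fin (𝕜 := ℝ) (n := N)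
  calc _ ≤ ∑ _i : Fin (Module.finrank ℝ (TangentSpace (𝓡 N) z)), b ^ 2 := by
        refine Finset.sum_le_sum fun i _ => ?_
        gcongr
        refine (hb _ ξ).trans ?_
        rw [(stdOrthonormalBasis ℝ (TangentSpace (𝓡 N) z)).norm_eq_one i, mul_one]
        exact mul_le_of_le_one_right hb0 hξ
    _ = N * b ^ 2 := by simp [hfin]

/-- Expand `w` in the orthonormal basis and apply Cauchy–Schwarz; no dimensional constant is lost in
this direction. -/
theorem strongMDirBound_of_strongDerivNorm_le {f : M → F →L[ℂ] G} {U : Set M} (hU : IsOpen U)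
    (hf : StronglyDiffOn N f U) {z : M} (hz : z ∈ U) {b : ℝ} (hb0 : 0 ≤ b)
    (hb : strongDerivNorm N f z ≤ ENNReal.ofReal b) (w : TangentSpace (𝓡 N) z) :
    StrongMDirBound f z w (b * ‖w‖) := by
  set e := stdOrthonormalBasis ℝ (TangentSpace (𝓡 N) z)
  let D : F → TangentSpace (𝓡 N) z →L[ℝ] G := fun ξ =>
    (NormedSpace.fromTangentSpace (𝕜 := ℝ) (f z ξ)).toContinuousLinearMap.comp
      (mfderiv (𝓡 N) 𝓘(ℝ, G) (fun y => f y ξ) z)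
  have h1 : ∀ ξ, ‖ξ‖ ≤ 1 → ‖D ξ w‖ ≤ b * ‖w‖ := by
    intro ξ hξ
    have h2 : Real.sqrt (∑ i, ‖D ξ (e i)‖ ^ 2) ≤ b := by
      rw [← ENNReal.ofReal_le_ofReal_iff hb0]
      refine le_trans ?_ hb
      exact le_iSup₂_of_le ξ hξ le_rfl
    have h3 : w = ∑ i, e.repr w i • e i := (e.sum_repr w).symm
    calc ‖D ξ w‖ = ‖∑ i, e.repr w i • D ξ (e i)‖ := by
          conv_lhs => rw [h3, map_sum]
          simp only [map_smul]
      _ ≤ ∑ i, ‖e.repr w i‖ * ‖D ξ (e i)‖ :=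
          (norm_sum_le _ _).trans (le_of_eq (by simp only [norm_smul]))
      _ ≤ Real.sqrt (∑ i, ‖e.repr w i‖ ^ 2) * Real.sqrt (∑ i, ‖D ξ (e i)‖ ^ 2) :=
          Real.sum_mul_le_sqrt_mul_sqrt _ _ _
      _ ≤ ‖w‖ * b := by
          rw [← EuclideanSpace.norm_eq, e.repr.norm_map]
          gcongr
      _ = _ := mul_comm _ _
  intro ξ
  rcases eq_or_ne ξ 0 with rfl | hξ
  · rw [fromTangentSpace_mfderiv (hf.mdifferentiableAt hU hz 0)]
    simp
    rfl
  · have h4 := h1 ((‖ξ‖⁻¹ : ℝ) • ξ) (by rw [norm_smul, norm_inv, norm_norm,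
      inv_mul_cancel₀ (norm_ne_zero_iff.2 hξ)])
    have h5 : D ((‖ξ‖⁻¹ : ℝ) • ξ) w = (‖ξ‖⁻¹ : ℝ) • D ξ w := by
      change NormedSpace.fromTangentSpace (𝕜 := ℝ) _ (mfderiv (𝓡 N) 𝓘(ℝ, G) _ z w) =
        (‖ξ‖⁻¹ : ℝ) • NormedSpace.fromTangentSpace (𝕜 := ℝ) _ (mfderiv (𝓡 N) 𝓘(ℝ, G) _ z w)
      rw [fromTangentSpace_mfderiv (hf.mdifferentiableAt hU hz ξ),
        fromTangentSpace_mfderiv (hf.mdifferentiableAt hU hz _)]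
      have h6 := (hf.strongC1On z).differentiableAt (isOpen_chartSet z hU) (mem_chartSet hz) ξ
      rw [show (fun u => f ((extChartAt (𝓡 N) z).symm u) ((‖ξ‖⁻¹ : ℝ) • ξ))
        = fun u => (‖ξ‖⁻¹ : ℝ) • f ((extChartAt (𝓡 N) z).symm u) ξ from
          funext fun u => ((f _).restrictScalars ℝ).map_smul _ _]
      rw [fderiv_fun_const_smul h6]
      rfl
    rw [h5, norm_smul, norm_inv, norm_norm,
      inv_mul_le_iff₀ (norm_pos_iff.2 hξ), mul_comm] at h4
    exact h4

end ManifoldStrong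

-- Differentiating a point-dependent bilinear form along a curve.

section BilinearForm

variable {E : Type*} [NormedAddCommGroup E] [NormedSpace ℝ E] {B : E → E →L[ℝ] E →L[ℝ] ℝ}

theorem fderiv_form_apply {u : E} (hB : DifferentiableAt ℝ B u) (a b d : E) :
    fderiv ℝ (fun u' => B u' a b) u d = fderiv ℝ B u d a b := by
  have h := ((hB.hasFDerivAt.clm_apply (hasFDerivAt_const a u)).clm_apply (hasFDerivAt_const b u))
  rw [h.fderiv]
  simp

theorem hasDerivAt_form {c v : ℝ → E} {a a' : E} {t : ℝ} (hB : DifferentiableAt ℝ B (c t))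
    (hc : HasDerivAt c a t) (hv : HasDerivAt v a' t) :
    HasDerivAt (fun s => B (c s) (v s) (v s))
      (fderiv ℝ B (c t) a (v t) (v t) + B (c t) a' (v t) + B (c t) (v t) a') t := by
  have h1 : HasDerivAt (fun s => B (c s)) (fderiv ℝ B (c t) a) t :=
    HasFDerivAt.comp_hasDerivAt (l := B) t hB.hasFDerivAt hc
  have h2 : HasDerivAt (fun s => B (c s) (v s)) (fderiv ℝ B (c t) a (v t) + B (c t) a') t :=
    h1.clm_apply hv
  exact h2.clm_apply hv

end BilinearForm

-- The metric in a chart and conservation of energy.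

section Energy

set_option linter.unusedSectionVars false

variable {N : ℕ} {M : Type*} [TopologicalSpace M] [ChartedSpace (EuclideanSpace ℝ (Fin N)) M]
  [IsManifold (𝓡 N) ∞ M]

variable (N) in
/-- The differential of the inverse of the chart at `x₀`. -/
def chartFrame (x₀ : M) (u : EuclideanSpace ℝ (Fin N)) :
    EuclideanSpace ℝ (Fin N) →L[ℝ] TangentSpace (𝓡 N) ((extChartAt (𝓡 N) x₀).symm u) :=
  (mfderiv 𝓘(ℝ, EuclideanSpace ℝ (Fin N)) (𝓡 N) (extChartAt (𝓡 N) x₀).symm u).comp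
    (NormedSpace.fromTangentSpace (𝕜 := ℝ) u).symm.toContinuousLinearMap

theorem chartFrame_injective (x₀ : M) {u : EuclideanSpace ℝ (Fin N)}
    (hu : u ∈ (extChartAt (𝓡 N) x₀).target) : Function.Injective (chartFrame N x₀ u) := by
  have h := isInvertible_mfderivWithin_extChartAt_symm (I := 𝓡 N) hu
  rw [modelWithCornersSelf_coe, range_id, mfderivWithin_univ] at h
  exact h.injective.comp (NormedSpace.fromTangentSpace (𝕜 := ℝ) u).symm.injective

theorem contMDiffOn_chartFrame (x₀ : M) (a : EuclideanSpace ℝ (Fin N)) :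
    ContMDiffOn 𝓘(ℝ, EuclideanSpace ℝ (Fin N)) (𝓡 N).tangent ∞
      (fun u => (⟨(extChartAt (𝓡 N) x₀).symm u, chartFrame N x₀ u a⟩ : TangentBundle (𝓡 N) M))
      (extChartAt (𝓡 N) x₀).target := by
  have h1 := (contMDiffOn_extChartAt_symm (I := 𝓡 N) (n := ∞) x₀).contMDiffOn_tangentMapWithin
    (m := ∞) le_rfl (isOpen_extChartAt_target x₀).uniqueMDiffOn
  have h2 : ContMDiff 𝓘(ℝ, EuclideanSpace ℝ (Fin N)) 𝓘(ℝ, EuclideanSpace ℝ (Fin N)).tangent ∞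
      (fun u => (⟨u, (NormedSpace.fromTangentSpace (𝕜 := ℝ) u).symm a⟩ :
        TangentBundle 𝓘(ℝ, EuclideanSpace ℝ (Fin N)) (EuclideanSpace ℝ (Fin N)))) :=
    contMDiff_vectorSpace_iff_contDiff.2 contDiff_const
  refine (h1.comp (h2.contMDiffOn (s := (extChartAt (𝓡 N) x₀).target)) fun u hu => hu).congr ?_
  intro u hu
  have h3 := mfderivWithin_of_isOpen (I := 𝓘(ℝ, EuclideanSpace ℝ (Fin N))) (I' := 𝓡 N)
    (f := (extChartAt (𝓡 N) x₀).symm) (isOpen_extChartAt_target (I := 𝓡 N) x₀) hu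
  simp only [tangentMapWithin, Function.comp_apply]
  rw [h3]
  rfl

variable [RiemannianBundle (fun x : M => TangentSpace (𝓡 N) x)]

variable (N) in
/-- The Riemannian metric in the coordinates of the chart at `x₀`, as a bilinear form. -/
def chartForm (x₀ : M) (u : EuclideanSpace ℝ (Fin N)) :
    EuclideanSpace ℝ (Fin N) →L[ℝ] EuclideanSpace ℝ (Fin N) →L[ℝ] ℝ :=
  (innerSL ℝ).bilinearComp (chartFrame N x₀ u) (chartFrame N x₀ u)

theorem chartForm_apply (x₀ : M) (u a b : EuclideanSpace ℝ (Fin N)) :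
    chartForm N x₀ u a b = chartMetric x₀ u a b := rfl

theorem chartForm_comm (x₀ : M) (u a b : EuclideanSpace ℝ (Fin N)) :
    chartForm N x₀ u a b = chartForm N x₀ u b a :=
  real_inner_comm (chartFrame N x₀ u b) (chartFrame N x₀ u a)

theorem eq_zero_of_chartForm_self {x₀ : M} {u a : EuclideanSpace ℝ (Fin N)}
    (hu : u ∈ (extChartAt (𝓡 N) x₀).target) (h : chartForm N x₀ u a a = 0) : a = 0 := by
  have h1 : chartFrame N x₀ u a = 0 := inner_self_eq_zero (𝕜 := ℝ).1 h
  exact chartFrame_injective x₀ hu (h1.trans (map_zero _).symm)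

variable [IsContMDiffRiemannianBundle (𝓡 N) ∞ (EuclideanSpace ℝ (Fin N))
      (fun x : M => TangentSpace (𝓡 N) x)]

theorem contDiffOn_chartForm (x₀ : M) :
    ContDiffOn ℝ ∞ (chartForm N x₀) (extChartAt (𝓡 N) x₀).target := by
  rw [contDiffOn_clm_apply]
  intro a
  rw [contDiffOn_clm_apply]
  intro b
  rw [← contMDiffOn_iff_contDiffOn]
  exact (contMDiffOn_chartFrame x₀ a).inner_bundle (contMDiffOn_chartFrame x₀ b)

/-- With all three arguments equal, two of the three derivative terms cancel. -/
theorem christoffel_self {x₀ : M} {u : EuclideanSpace ℝ (Fin N)}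
    (hu : u ∈ (extChartAt (𝓡 N) x₀).target) (a : EuclideanSpace ℝ (Fin N)) :
    christoffel x₀ u a a a = fderiv ℝ (chartForm N x₀) u a a a / 2 := by
  have h1 : DifferentiableAt ℝ (chartForm N x₀) u :=
    ((contDiffOn_chartForm x₀).contDiffAt
      ((isOpen_extChartAt_target x₀).mem_nhds hu)).differentiableAt (by simp)
  have h2 := fderiv_form_apply h1 a a a
  simp only [chartForm_apply] at h2
  unfold christoffel
  rw [h2]
  ring

/-- Conservation of energy for geodesics, in a chart. -/
theorem IsGeodesicOn.hasDerivAt_energy {γ : ℝ → M} {J : Set ℝ}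
    (hγ : IsGeodesicOn (N := N) γ J) {x₀ : M} {t : ℝ} (ht : t ∈ J)
    (htx : γ t ∈ (extChartAt (𝓡 N) x₀).source) {c : ℝ → EuclideanSpace ℝ (Fin N)}
    (hc : c = fun s => extChartAt (𝓡 N) x₀ (γ s)) (hcd : ContDiffAt ℝ ∞ c t) :
    HasDerivAt (fun s => chartForm N x₀ (c s) (deriv c s) (deriv c s)) 0 t := by
  have hct : c t ∈ (extChartAt (𝓡 N) x₀).target := by
    rw [hc]; exact (extChartAt (𝓡 N) x₀).map_source htx
  have h1 : DifferentiableAt ℝ (chartForm N x₀) (c t) :=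
    ((contDiffOn_chartForm x₀).contDiffAt
      ((isOpen_extChartAt_target x₀).mem_nhds hct)).differentiableAt (by simp)
  have h2 : HasDerivAt c (deriv c t) t := (hcd.differentiableAt (by simp)).hasDerivAt
  have h3 : HasDerivAt (deriv c) (deriv (deriv c) t) t := by
    have : ContDiffAt ℝ ∞ (fun s => fderiv ℝ c s 1) t :=
      (hcd.fderiv_right (m := ∞) le_rfl).clm_apply contDiffAt_const
    exact (this.differentiableAt (by simp)).hasDerivAt
  have h5 := hasDerivAt_form h1 h2 h3
  -- Pairing the geodesic equation with `w = c'` gives `g(c'', c') + (∂_{c'} g)(c', c') / 2 = 0`,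
  -- half the derivative of the energy.
  have h6 := hγ.2 t ht x₀ htx (deriv c t)
  have hct' : extChartAt (𝓡 N) x₀ (γ t) = c t := by rw [hc]
  simp only [← hc, hct'] at h6
  rw [christoffel_self hct, ← chartForm_apply] at h6
  convert h5 using 1
  rw [chartForm_comm x₀ (c t) (deriv c t)]
  linarith

end Energy

-- The value `exp_x 0 = x`, normal balls, and the radial mean value estimate.

section ExponentialMap

set_option linter.unusedSectionVars false

variable {N : ℕ} {M : Type*} [TopologicalSpace M] [ChartedSpace (EuclideanSpace ℝ (Fin N)) M]
  [IsManifold (𝓡 N) ∞ M] [RiemannianBundle (fun x : M => TangentSpace (𝓡 N) x)]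
  [IsContMDiffRiemannianBundle (𝓡 N) ∞ (EuclideanSpace ℝ (Fin N))
      (fun x : M => TangentSpace (𝓡 N) x)]

/-- A geodesic whose coordinate velocity vanishes somewhere near `t₀` is constant near `t₀`. -/
theorem IsGeodesicOn.exists_ball_eq_of_deriv_eq_zero {γ : ℝ → M} {J : Set ℝ} (hJ : IsOpen J)
    (hγ : IsGeodesicOn (N := N) γ J) {t₀ : ℝ} (ht₀ : t₀ ∈ J) :
    ∃ δ > 0, ∀ t ∈ Metric.ball t₀ δ, deriv (fun s => extChartAt (𝓡 N) (γ t₀) (γ s)) t = 0 →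
      ∀ s ∈ Metric.ball t₀ δ, γ s = γ t₀ := by
  set φ := extChartAt (𝓡 N) (γ t₀) with hφ
  have hcont : ContinuousOn γ J := hγ.1.continuousOn
  have hW : IsOpen (J ∩ γ ⁻¹' φ.source) :=
    hcont.isOpen_inter_preimage hJ (isOpen_extChartAt_source _)
  obtain ⟨δ, hδ, hsub⟩ := Metric.isOpen_iff.1 hW t₀ ⟨ht₀, mem_extChartAt_source _⟩
  set c : ℝ → EuclideanSpace ℝ (Fin N) := fun s => φ (γ s) with hc
  have hcd : ∀ t ∈ Metric.ball t₀ δ, ContDiffAt ℝ ∞ c t := by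
    intro t ht
    rw [← contMDiffAt_iff_contDiffAt]
    have h1 := hγ.1.contMDiffAt (hJ.mem_nhds (hsub ht).1)
    have h2 : ContMDiffAt (𝓡 N) 𝓘(ℝ, EuclideanSpace ℝ (Fin N)) ∞ φ (γ t) :=
      contMDiffAt_extChartAt' (by simpa [hφ] using (hsub ht).2)
    exact h2.comp t h1
  have hE : ∀ t ∈ Metric.ball t₀ δ,
      HasDerivAt (fun s => chartForm N (γ t₀) (c s) (deriv c s) (deriv c s)) 0 t :=
    fun t ht => hγ.hasDerivAt_energy (hsub ht).1 (hsub ht).2 hc (hcd t ht)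
  have hpre : IsPreconnected (Metric.ball t₀ δ) := (convex_ball t₀ δ).isPreconnected
  refine ⟨δ, hδ, fun t ht h0 s hs => ?_⟩
  -- The energy is constant on the ball and vanishes at `t`; positive definiteness kills the
  -- velocity everywhere.
  have hzero : ∀ s ∈ Metric.ball t₀ δ, deriv c s = 0 := by
    intro s hs
    have h1 := Metric.isOpen_ball.is_const_of_deriv_eq_zero hpre
      (fun r hr => (hE r hr).differentiableAt.differentiableWithinAt)
      (fun r hr => (hE r hr).deriv) hs ht
    rw [h0, map_zero] at h1
    exact eq_zero_of_chartForm_self (φ.map_source (hsub hs).2) h1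
  have h2 := Metric.isOpen_ball.is_const_of_deriv_eq_zero hpre
    (fun r hr => ((hcd r hr).differentiableAt (by simp)).differentiableWithinAt)
    (fun r hr => hzero r hr) hs (Metric.mem_ball_self hδ)
  exact φ.injOn (hsub hs).2 (mem_extChartAt_source _) h2

/-- The set of times near which `γ` is constantly `γ 0` is open, contains `0`, and is closed in the
interval by the local result, so connectedness replaces a uniqueness theorem for the geodesic
equation. -/
theorem IsGeodesicFrom.eq_of_velocity_eq_zero {x : M} {γ : ℝ → M}
    (hγ : IsGeodesicFrom x (0 : TangentSpace (𝓡 N) x) γ) : γ 1 = x := by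
  obtain ⟨⟨ε, hε, hJ⟩, h0⟩ := hγ
  have hx : γ 0 = x := congrArg TotalSpace.proj h0
  have hmem0 : (0 : ℝ) ∈ Ioo (-ε) (1 + ε) := ⟨by linarith, by linarith⟩
  have hmem1 : (1 : ℝ) ∈ Ioo (-ε) (1 + ε) := ⟨by linarith, by linarith⟩
  subst hx
  have hv : mfderiv 𝓘(ℝ, ℝ) (𝓡 N) γ 0 ((NormedSpace.fromTangentSpace (𝕜 := ℝ) (0 : ℝ)).symm 1)
      = 0 := by
    have := (TotalSpace.mk.injEq _ _ _ _).mp h0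
    exact eq_of_heq this.2
  set S : Set ℝ := {t | ∀ᶠ s in 𝓝 t, γ s = γ 0} with hS
  have hSo : IsOpen S := isOpen_setOfPred_eventually_nhds
  have key : ∀ t₀ ∈ Ioo (-ε) (1 + ε), ∃ δ > 0, ∀ t ∈ Metric.ball t₀ δ,
      deriv (fun s => extChartAt (𝓡 N) (γ t₀) (γ s)) t = 0 →
      ∀ s ∈ Metric.ball t₀ δ, γ s = γ t₀ :=
    fun t₀ ht₀ => hJ.exists_ball_eq_of_deriv_eq_zero isOpen_Ioo ht₀
  have h0S : (0 : ℝ) ∈ S := by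
    obtain ⟨δ, hδ, h⟩ := key 0 hmem0
    refine Filter.mem_of_superset (Metric.ball_mem_nhds 0 hδ)
      (h 0 (Metric.mem_ball_self hδ) ?_)
    have hd : MDifferentiableAt 𝓘(ℝ, ℝ) (𝓡 N) γ 0 :=
      (hJ.1.contMDiffAt (isOpen_Ioo.mem_nhds hmem0)).mdifferentiableAt (by simp)
    have hφ : MDifferentiableAt (𝓡 N) 𝓘(ℝ, EuclideanSpace ℝ (Fin N)) (extChartAt (𝓡 N) (γ 0))
        (γ 0) := mdifferentiableAt_extChartAt (mem_chart_source _ _)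
    let L : ℝ →L[ℝ] EuclideanSpace ℝ (Fin N) :=
      (mfderiv (𝓡 N) 𝓘(ℝ, EuclideanSpace ℝ (Fin N)) (extChartAt (𝓡 N) (γ 0)) (γ 0)).comp
        (mfderiv 𝓘(ℝ, ℝ) (𝓡 N) γ 0)
    have h1 : HasFDerivAt (fun s => extChartAt (𝓡 N) (γ 0) (γ s)) L 0 :=
      (hφ.hasMFDerivAt.comp (0 : ℝ) hd.hasMFDerivAt).hasFDerivAt
    have h2 := h1.hasDerivAt.deriv
    refine h2.trans ?_
    change mfderiv (𝓡 N) 𝓘(ℝ, EuclideanSpace ℝ (Fin N)) (extChartAt (𝓡 N) (γ 0)) (γ 0)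
      (mfderiv 𝓘(ℝ, ℝ) (𝓡 N) γ 0 ((NormedSpace.fromTangentSpace (𝕜 := ℝ) (0 : ℝ)).symm 1)) = 0
    rw [hv, map_zero]
  have hsub : Ioo (-ε) (1 + ε) ⊆ S := by
    refine isPreconnected_Ioo.subset_of_closure_inter_subset hSo ⟨0, hmem0, h0S⟩ ?_
    rintro t₀ ⟨hcl, ht₀⟩
    obtain ⟨δ, hδ, h⟩ := key t₀ ht₀
    obtain ⟨t, ht, htS⟩ := mem_closure_iff_nhds.1 hcl _ (Metric.ball_mem_nhds t₀ hδ)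
    have hd : deriv (fun s => extChartAt (𝓡 N) (γ t₀) (γ s)) t = 0 := by
      have : (fun s => extChartAt (𝓡 N) (γ t₀) (γ s)) =ᶠ[𝓝 t]
          fun _ => extChartAt (𝓡 N) (γ t₀) (γ 0) := by
        filter_upwards [htS] with s hs
        rw [hs]
      rw [this.deriv_eq, deriv_const]
    have h3 := h t ht hd
    have h4 : γ t₀ = γ 0 := (h3 t ht).symm.trans htS.self_of_nhds
    exact Filter.mem_of_superset (Metric.ball_mem_nhds t₀ hδ) fun s hs => (h3 s hs).trans h4
  exact (hsub hmem1).self_of_nhds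

theorem expMap_zero {x : M} (h : ∃ γ : ℝ → M, IsGeodesicFrom x (0 : TangentSpace (𝓡 N) x) γ) :
    expMap x (0 : TangentSpace (𝓡 N) x) = x := by
  unfold expMap
  rw [dif_pos h]
  exact h.choose_spec.eq_of_velocity_eq_zero

/-- The restriction of a partial diffeomorphism to an open subset of its source. -/
def PartialDiffeomorph.restrOpenSource {E : Type*} [NormedAddCommGroup E] [NormedSpace ℝ E]
    (Φ : PartialDiffeomorph 𝓘(ℝ, E) (𝓡 N) E M ∞) (s : Set E) (hs : IsOpen s) :
    PartialDiffeomorph 𝓘(ℝ, E) (𝓡 N) E M ∞ where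
  toPartialEquiv := (Φ.toOpenPartialHomeomorph.restrOpen s hs).toPartialEquiv
  open_source := (Φ.toOpenPartialHomeomorph.restrOpen s hs).open_source
  open_target := (Φ.toOpenPartialHomeomorph.restrOpen s hs).open_target
  contMDiffOn_toFun := Φ.contMDiffOn_toFun.mono inter_subset_left
  contMDiffOn_invFun := Φ.contMDiffOn_invFun.mono inter_subset_left

theorem IsNormalChartInv.restr {x : M} {r s : ℝ} (hrs : r ≤ s)
    {Φ : PartialDiffeomorph 𝓘(ℝ, TangentSpace (𝓡 N) x) (𝓡 N) (TangentSpace (𝓡 N) x) M ∞}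
    (h : IsNormalChartInv x s Φ) :
    IsNormalChartInv x r (Φ.restrOpenSource (Metric.ball 0 r) Metric.isOpen_ball) := by
  refine ⟨?_, fun v hv => h.2 v (Metric.ball_subset_ball hrs hv)⟩
  change Φ.source ∩ Metric.ball 0 r = _
  rw [h.1]
  exact inter_eq_right.2 (Metric.ball_subset_ball hrs)

theorem IsNormalChartInv.target_eq {x : M} {r : ℝ}
    {Φ : PartialDiffeomorph 𝓘(ℝ, TangentSpace (𝓡 N) x) (𝓡 N) (TangentSpace (𝓡 N) x) M ∞}
    (h : IsNormalChartInv x r Φ) : Φ.target = normalBall (N := N) x r := by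
  rw [← Φ.image_source_eq_target, h.1]
  exact image_congr fun v hv => (h.2 v hv).2

theorem IsNormalChartInv.isOpen_normalBall {x : M} {r : ℝ}
    {Φ : PartialDiffeomorph 𝓘(ℝ, TangentSpace (𝓡 N) x) (𝓡 N) (TangentSpace (𝓡 N) x) M ∞}
    (h : IsNormalChartInv x r Φ) : IsOpen (normalBall (N := N) x r) :=
  h.target_eq ▸ Φ.open_target

theorem IsNormalChartInv.mem_normalBall {x : M} {r : ℝ} (hr : 0 < r)
    {Φ : PartialDiffeomorph 𝓘(ℝ, TangentSpace (𝓡 N) x) (𝓡 N) (TangentSpace (𝓡 N) x) M ∞}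
    (h : IsNormalChartInv x r Φ) : x ∈ normalBall (N := N) x r :=
  ⟨0, Metric.mem_ball_self hr, expMap_zero (h.2 0 (Metric.mem_ball_self hr)).1⟩

theorem IsNormalChartInv.mdifferentiableAt {x : M} {r : ℝ}
    {Φ : PartialDiffeomorph 𝓘(ℝ, TangentSpace (𝓡 N) x) (𝓡 N) (TangentSpace (𝓡 N) x) M ∞}
    (h : IsNormalChartInv x r Φ) {v : TangentSpace (𝓡 N) x} (hv : v ∈ Metric.ball 0 r) :
    MDifferentiableAt 𝓘(ℝ, TangentSpace (𝓡 N) x) (𝓡 N) (expMap x) v := by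
  refine (Φ.mdifferentiableAt (by simp) (h.1 ▸ hv)).congr_of_eventuallyEq ?_
  filter_upwards [Metric.isOpen_ball.mem_nhds hv] with w hw
  exact ((h.2 w hw).2).symm

theorem IsBoundedGeometryRadius.isInjRadius {s : ℝ} (h : IsBoundedGeometryRadius N M s) :
    IsInjRadius N M s :=
  ⟨h.1, fun x => by
    obtain ⟨C, hC⟩ := h.2
    obtain ⟨Φ, hΦ, -⟩ := hC x
    exact ⟨Φ, hΦ⟩⟩

theorem IsBoundedGeometryRadius.mono {r s : ℝ} (h : IsBoundedGeometryRadius N M s) (hr : 0 < r)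
    (hrs : r ≤ s) : IsBoundedGeometryRadius N M r := by
  obtain ⟨C, hC⟩ := h.2
  refine ⟨hr, C, fun x => ?_⟩
  obtain ⟨Φ, hΦ, h1, h2⟩ := hC x
  refine ⟨_, hΦ.restr hrs, fun v hv => h1 v (Metric.ball_subset_ball hrs hv), fun y hy => ?_⟩
  exact h2 y hy.1

/-- The value at the end of a radial geodesic differs from that at the centre by at most the radius
times the bounds of the derivatives. -/
theorem IsNormalChartInv.norm_sub_le {G : Type*} [NormedAddCommGroup G] [NormedSpace ℝ G]
    {x : M} {r s : ℝ} (hr : 0 < r) (hrs : r ≤ s)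
    {Φ : PartialDiffeomorph 𝓘(ℝ, TangentSpace (𝓡 N) x) (𝓡 N) (TangentSpace (𝓡 N) x) M ∞}
    (h : IsNormalChartInv x s Φ) {g : M → G} {L K : ℝ} (hL : 0 ≤ L) (hK : 0 ≤ K)
    (hg : ∀ y, MDifferentiableAt (𝓡 N) 𝓘(ℝ, G) g y)
    (hgL : ∀ y (w : TangentSpace (𝓡 N) y), ‖NormedSpace.fromTangentSpace (𝕜 := ℝ) (g y)
      (mfderiv (𝓡 N) 𝓘(ℝ, G) g y w)‖ ≤ L * ‖w‖)
    (hexp : ∀ v ∈ Metric.ball (0 : TangentSpace (𝓡 N) x) s, ‖dexp x v‖ ≤ K)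
    {y : M} (hy : y ∈ normalBall (N := N) x r) : ‖g y - g x‖ ≤ L * (K * r) := by
  obtain ⟨v, hv, rfl⟩ := hy
  have hvr : ‖v‖ < r := by simpa using hv
  have hx : expMap x (0 : TangentSpace (𝓡 N) x) = x :=
    expMap_zero (h.2 0 (Metric.mem_ball_self (hr.trans_le hrs))).1
  have hball : ∀ t ∈ Icc (0 : ℝ) 1, t • v ∈ Metric.ball (0 : TangentSpace (𝓡 N) x) s := by
    intro t ht
    rw [mem_ball_zero_iff, norm_smul, Real.norm_of_nonneg ht.1]
    exact (mul_le_of_le_one_left (norm_nonneg v) ht.2).trans_lt (hvr.trans_le hrs)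
  -- Only smoothness of `t ↦ exp_x (t v)` enters, through the chain rule; that this curve is a
  -- geodesic plays no role.
  let f' : ℝ → G := fun t => NormedSpace.fromTangentSpace (𝕜 := ℝ) (g (expMap x (t • v)))
    (mfderiv (𝓡 N) 𝓘(ℝ, G) g (expMap x (t • v)) (dexp x (t • v) v))
  have hder : ∀ t ∈ Icc (0 : ℝ) 1, HasDerivAt (fun t : ℝ => g (expMap x (t • v))) (f' t) t := by
    intro t ht
    have h1 := ((hg (expMap x (t • v))).hasMFDerivAt.comp (t • v)
      (h.mdifferentiableAt (hball t ht)).hasMFDerivAt).hasFDerivAt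
    have h2 : HasDerivAt (fun t : ℝ => t • v) v t := by
      simpa using (hasDerivAt_id t).smul_const v
    exact HasFDerivAt.comp_hasDerivAt t h1 h2
  have h3 := norm_image_sub_le_of_norm_deriv_le_segment_01' (C := L * (K * r))
    (fun t ht => (hder t ht).hasDerivWithinAt) (fun t ht => ?_)
  · simpa [hx] using h3
  · refine (hgL _ _).trans ?_
    gcongr
    exact ((dexp x (t • v)).le_opNorm v).trans (by
      gcongr
      exact hexp _ (hball t ⟨ht.1, ht.2.le⟩))

end ExponentialMap

-- Unitary operators between different Hilbert spaces.

section Unitary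

set_option linter.unusedSectionVars false

variable {F G K : Type*} [NormedAddCommGroup F] [InnerProductSpace ℂ F] [CompleteSpace F]
  [NormedAddCommGroup G] [InnerProductSpace ℂ G] [CompleteSpace G]
  [NormedAddCommGroup K] [InnerProductSpace ℂ K] [CompleteSpace K]

theorem IsUnitaryMap.adjoint {T : F →L[ℂ] G} (hT : IsUnitaryMap T) :
    IsUnitaryMap (ContinuousLinearMap.adjoint T) :=
  ⟨by rw [ContinuousLinearMap.adjoint_adjoint]; exact hT.2,
    by rw [ContinuousLinearMap.adjoint_adjoint]; exact hT.1⟩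

theorem IsUnitaryMap.comp {S : G →L[ℂ] K} {T : F →L[ℂ] G} (hS : IsUnitaryMap S)
    (hT : IsUnitaryMap T) : IsUnitaryMap (S.comp T) := by
  rw [IsUnitaryMap, ContinuousLinearMap.adjoint_comp]
  constructor
  · rw [ContinuousLinearMap.comp_assoc, ← ContinuousLinearMap.comp_assoc _ S T, hS.1,
      ContinuousLinearMap.id_comp, hT.1]
  · rw [ContinuousLinearMap.comp_assoc, ← ContinuousLinearMap.comp_assoc T, hT.2,
      ContinuousLinearMap.id_comp, hS.2]

theorem LinearIsometryEquiv.isUnitaryMap (u : F ≃ₗᵢ[ℂ] G) :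
    IsUnitaryMap (u.toContinuousLinearEquiv : F →L[ℂ] G) := by
  have h : ContinuousLinearMap.adjoint (u.toContinuousLinearEquiv : F →L[ℂ] G)
      = (u.symm.toContinuousLinearEquiv : G →L[ℂ] F) := u.adjoint_eq_symm
  rw [IsUnitaryMap, h]
  constructor
  · ext v; simp
  · ext v; simp

theorem IsUnitaryMap.nonempty_linearIsometryEquiv {T : F →L[ℂ] G} (hT : IsUnitaryMap T) :
    Nonempty (F ≃ₗᵢ[ℂ] G) := by
  refine ⟨LinearIsometryEquiv.ofSurjective
    ⟨T.toLinearMap, (ContinuousLinearMap.norm_map_iff_adjoint_comp_self T).2 hT.1⟩ fun v => ?_⟩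
  exact ⟨ContinuousLinearMap.adjoint T v, congrArg (fun S : G →L[ℂ] G => S v) hT.2⟩

theorem LinearIsometryEquiv.norm_toContinuousLinearMap_le (u : F ≃ₗᵢ[ℂ] G) :
    ‖(u.toContinuousLinearEquiv : F →L[ℂ] G)‖ ≤ 1 :=
  ContinuousLinearMap.opNorm_le_bound _ zero_le_one fun v => by
    rw [one_mul]; exact (u.norm_map v).le

end Unitary

-- Changing the typical fibres of a Hilbert bundle by unitaries.

section Twist

set_option linter.unusedSectionVars false

variable {N : ℕ} {M : Type*} [TopologicalSpace M] [ChartedSpace (EuclideanSpace ℝ (Fin N)) M]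
  [IsManifold (𝓡 N) ∞ M] [RiemannianBundle (fun x : M => TangentSpace (𝓡 N) x)]
  [IsContMDiffRiemannianBundle (𝓡 N) ∞ (EuclideanSpace ℝ (Fin N))
      (fun x : M => TangentSpace (𝓡 N) x)]

/-- The transition maps become `u_x τ u_y⁻¹`. The outer factors are constant contractions, so
directional bounds persist; returning to the derivative norm costs at most `√N`. -/
theorem IsHilbertBundle.postcomp {r : ℝ} {Z : Type*} [TopologicalSpace Z] {p : Z → M}
    {F F' : M → Type*} [∀ x, NormedAddCommGroup (F x)] [∀ x, InnerProductSpace ℂ (F x)]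
    [∀ x, CompleteSpace (F x)] [∀ x, NormedAddCommGroup (F' x)] [∀ x, InnerProductSpace ℂ (F' x)]
    [∀ x, CompleteSpace (F' x)]
    {ψ : ∀ x : M, p ⁻¹' normalBall (N := N) x r → normalBall (N := N) x r × F x}
    (hU : ∀ x : M, IsOpen (normalBall (N := N) x r))
    (h : IsHilbertBundle r p F ψ) (u : ∀ x, F x ≃ₗᵢ[ℂ] F' x) :
    IsHilbertBundle r p F' (fun x ξ => ((ψ x ξ).1, u x (ψ x ξ).2)) where
  boundedGeometryRadius := h.boundedGeometryRadius
  lt_injRadius := h.lt_injRadius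
  separable x := by
    have := h.separable x
    exact (u x).surjective.denseRange.separableSpace (u x).continuous
  fibers_iso x y := by
    obtain ⟨v⟩ := h.fibers_iso x y
    exact ⟨(u x).symm.trans (v.trans (u y))⟩
  t2 := h.t2
  continuous := h.continuous
  surjective := h.surjective
  homeo x := (((Homeomorph.refl _).prodCongr (u x).toHomeomorph).isHomeomorph).comp (h.homeo x)
  fiber_preserving x ξ := h.fiber_preserving x ξ
  transition := by
    obtain ⟨τ, h1, h2, h3, h4⟩ := h.transition
    set B := ⨆ x, ⨆ y, ⨆ z ∈ normalBall (N := N) x r ∩ normalBall (N := N) y r,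
      strongDerivNorm N (τ x y) z with hB
    let Uc : ∀ x, F x →L[ℂ] F' x := fun x => (u x).toContinuousLinearEquiv
    let Vc : ∀ x, F' x →L[ℂ] F x := fun x => (u x).symm.toContinuousLinearEquiv
    have hUV : ∀ x y, IsOpen (normalBall (N := N) x r ∩ normalBall (N := N) y r) :=
      fun x y => (hU x).inter (hU y)
    have hs : ∀ x y, StronglyDiffOn N (fun z => (τ x y z).comp (Vc y))
        (normalBall (N := N) x r ∩ normalBall (N := N) y r) := fun x y =>
      (h3 x y).comp (hUV x y) (stronglyDiffOn_const _ _)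
    refine ⟨fun x y z => (Uc x).comp ((τ x y z).comp (Vc y)), fun x y z hz => ?_,
      fun x y ξ hx hy => ?_, fun x y => ?_, ?_⟩
    · exact (u x).isUnitaryMap.comp ((h1 x y z hz).comp (u y).symm.isUnitaryMap)
    · change u x (ψ x ⟨ξ, hx⟩).2 = u x (τ x y (p ξ) ((u y).symm (u y (ψ y ⟨ξ, hy⟩).2)))
      rw [h2 x y ξ hx hy, LinearIsometryEquiv.symm_apply_apply]
    · exact (stronglyDiffOn_const (Uc x) _).comp (hUV x y) (hs x y)
    · refine lt_of_le_of_lt (b := ENNReal.ofReal (Real.sqrt N * B.toReal)) ?_ ENNReal.ofReal_lt_top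
      refine iSup_le fun x => iSup_le fun y => iSup₂_le fun z hz => ?_
      refine strongDerivNorm_le ENNReal.toReal_nonneg fun w => ?_
      have h5 : strongDerivNorm N (τ x y) z ≤ ENNReal.ofReal B.toReal := by
        rw [ENNReal.ofReal_toReal h4.ne]
        exact le_iSup_of_le x (le_iSup_of_le y (le_iSup₂_of_le z hz le_rfl))
      have h6 := strongMDirBound_of_strongDerivNorm_le (hUV x y) (h3 x y) hz
        ENNReal.toReal_nonneg h5 w
      have hb : 0 ≤ B.toReal * ‖w‖ := by positivity
      have h7 := StrongMDirBound.comp (hUV x y) (h3 x y) (stronglyDiffOn_const (Vc y) _) hz hb h6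
        (strongMDirBound_const (Vc y) z w)
      have h8 := StrongMDirBound.comp (hUV x y) (stronglyDiffOn_const (Uc x) _) (hs x y) hz le_rfl
        (strongMDirBound_const (Uc x) z w) h7
      refine h8.mono ?_
      have hu1 : ‖Uc x‖ ≤ 1 := (u x).norm_toContinuousLinearMap_le
      have hv1 : ‖Vc y‖ ≤ 1 := (u y).symm.norm_toContinuousLinearMap_le
      calc _ = ‖Uc x‖ * (B.toReal * ‖w‖ * ‖Vc y‖) := by ring
        _ ≤ 1 * (B.toReal * ‖w‖ * 1) := by gcongr
        _ = _ := by ring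

end Twist

-- The topology and local trivializations of `Im(P)`.

section ImageBundle

set_option linter.unusedSectionVars false

variable {H : Type*} [NormedAddCommGroup H] [InnerProductSpace ℂ H] [CompleteSpace H]
  {M : Type*}

/-- The inclusion of `Im(P)` into the product bundle `M × H`. -/
def ImBundle.toProd {P : M → Projection H} (ξ : ImBundle P) : M × H := (ξ.base, ξ.vec)

theorem ImBundle.toProd_injective {P : M → Projection H} :
    Function.Injective (ImBundle.toProd (P := P)) := by
  rintro ⟨x, v⟩ ⟨y, w⟩ h
  obtain ⟨h1, h2⟩ := Prod.mk.inj h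
  subst h1
  exact congrArg (ImBundle.mk x) (Subtype.ext h2)

variable [TopologicalSpace M]

/-- The subspace topology of `Im(P) ⊆ M × H`. -/
abbrev imSubspaceTopology (P : M → Projection H) : TopologicalSpace (ImBundle P) :=
  TopologicalSpace.induced ImBundle.toProd inferInstance

theorem ImBundle.continuous_base {P : M → Projection H} :
    letI := imSubspaceTopology P
    Continuous (ImBundle.base (P := P)) := by
  let := imSubspaceTopology P
  have hj : Continuous (ImBundle.toProd (P := P)) := continuous_induced_dom
  exact continuous_fst.comp hj

variable {N : ℕ} [ChartedSpace (EuclideanSpace ℝ (Fin N)) M]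
  [IsManifold (𝓡 N) ∞ M] [RiemannianBundle (fun x : M => TangentSpace (𝓡 N) x)]
  [IsContMDiffRiemannianBundle (𝓡 N) ∞ (EuclideanSpace ℝ (Fin N))
      (fun x : M => TangentSpace (𝓡 N) x)]
  {P : M → Projection H} {r : ℝ}

theorem stronglyDiffOn_compression (hP : StronglyDiffOn N (fun x => (P x).1) univ) (x : M) :
    StronglyDiffOn N (fun z => compression (P x) (P z)) univ :=
  (stronglyDiffOn_const (P x).toRange _).comp isOpen_univ
    (hP.comp isOpen_univ (stronglyDiffOn_const (P x).range.subtypeL _))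

theorem stronglyDiffOn_invSqrt_compression (hP : StronglyDiffOn N (fun x => (P x).1) univ) (x : M)
    {U : Set M} (hU : IsOpen U) (hd : ∀ y ∈ U, ‖(P x).1 - (P y).1‖ ≤ 1 / 4) :
    StronglyDiffOn N (fun z => invSqrt (compression (P x) (P z))) U :=
  StronglyDiffOn.invSqrt hU ((stronglyDiffOn_compression hP x).one_sub.mono (subset_univ _))
    (fun _ _ => IsSelfAdjoint.of_nonneg (compression_nonneg _ _))
    fun z hz => (norm_one_sub_compression_le _ _).trans (hd z hz)

/-- Unitarity makes `ξ ↦ W ξ` over each base point the inverse. Both directions are continuous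
because `P` and `T^{-1/2}` depend continuously on the point in operator norm. -/
theorem isHomeomorph_imTriv (hP : StronglyDiffOn N (fun x => (P x).1) univ)
    (hU : ∀ x : M, IsOpen (normalBall (N := N) x r))
    (hd : ∀ x : M, ∀ y ∈ normalBall (N := N) x r, ‖(P x).1 - (P y).1‖ ≤ 1 / 4) (x : M) :
    letI := imSubspaceTopology P
    IsHomeomorph (imTriv N P r x) := by
  let := imSubspaceTopology P
  have hj : Continuous (ImBundle.toProd (P := P)) := continuous_induced_dom
  have hS := (stronglyDiffOn_invSqrt_compression hP x (hU x) (hd x)).continuousOn (hU x)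
  have hPc : Continuous fun y => (P y).1 := by
    rw [← continuousOn_univ]; exact hP.continuousOn isOpen_univ
  have hunit : ∀ y ∈ normalBall (N := N) x r, IsUnitaryMap (connector (P x) (P y)) := fun y hy =>
    isUnitaryMap_connector ((hd x y hy).trans_lt (by norm_num))
  rw [isHomeomorph_iff_exists_inverse]
  refine ⟨?_, fun q => ⟨⟨q.1, connector (P x) (P q.1) q.2⟩, q.1.2⟩, ?_, ?_, ?_⟩
  · have hb : Continuous fun ξ : ImBundle.base (P := P) ⁻¹' normalBall (N := N) x r => ξ.1.base :=
      (continuous_fst.comp hj).comp continuous_subtype_val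
    have hv : Continuous fun ξ : ImBundle.base (P := P) ⁻¹' normalBall (N := N) x r =>
        (ξ.1.vec : H) := (continuous_snd.comp hj).comp continuous_subtype_val
    refine (hb.subtype_mk _).prodMk ?_
    have h1 : Continuous fun ξ : ImBundle.base (P := P) ⁻¹' normalBall (N := N) x r =>
        invSqrt (compression (P x) (P ξ.1.base)) ((P x).toRange (ξ.1.vec : H)) :=
      (hS.comp_continuous hb fun ξ => ξ.2).clm_apply ((P x).toRange.continuous.comp hv)
    refine h1.congr fun ξ => ?_
    rw [adjoint_connector]
    rfl
  · intro ξ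
    have h := congrArg (fun T => T ξ.1.vec) (hunit ξ.1.base ξ.2).2
    exact Subtype.ext (congrArg (ImBundle.mk ξ.1.base) h)
  · intro q
    have h := congrArg (fun T => T q.2) (hunit q.1 q.1.2).1
    exact Prod.ext rfl h
  · refine Continuous.subtype_mk (continuous_induced_rng.2 ?_) _
    refine (continuous_subtype_val.comp continuous_fst).prodMk ?_
    have hb : Continuous fun q : normalBall (N := N) x r × (P x).range => (q.1 : M) :=
      continuous_subtype_val.comp continuous_fst
    exact (hPc.comp hb).clm_apply (continuous_subtype_val.comp
      ((hS.comp_continuous hb fun q => q.1.2).clm_apply continuous_snd))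

theorem mem_imBasis_iff (hP : StronglyDiffOn N (fun x => (P x).1) univ)
    (hU : ∀ x : M, IsOpen (normalBall (N := N) x r))
    (hd : ∀ x : M, ∀ y ∈ normalBall (N := N) x r, ‖(P x).1 - (P y).1‖ ≤ 1 / 4)
    {V : Set (ImBundle P)} :
    V ∈ imBasis N P r ↔ (∃ x : M, V ⊆ ImBundle.base ⁻¹' normalBall (N := N) x r) ∧
      IsOpen[imSubspaceTopology P] V := by
  let := imSubspaceTopology P
  have hbase : Continuous (ImBundle.base (P := P)) := ImBundle.continuous_base
  have key : ∀ x, V ⊆ ImBundle.base ⁻¹' normalBall (N := N) x r →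
      (IsOpen (imTriv N P r x '' (Subtype.val ⁻¹' V)) ↔ IsOpen V) := by
    intro x hV
    let e := (isHomeomorph_imTriv hP hU hd x).homeomorph
    have h1 : IsOpen (imTriv N P r x '' (Subtype.val ⁻¹' V)) ↔
        IsOpen (Subtype.val ⁻¹' V : Set (ImBundle.base (P := P) ⁻¹' normalBall (N := N) x r)) :=
      e.isOpen_image
    rw [h1, ((hU x).preimage hbase).isOpenEmbedding_subtypeVal.isOpen_iff_image_isOpen,
      Subtype.image_preimage_coe, inter_eq_right.2 hV]
  constructor
  · rintro ⟨x, hV, ho⟩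
    exact ⟨⟨x, hV⟩, (key x hV).1 ho⟩
  · rintro ⟨⟨x, hV⟩, ho⟩
    exact ⟨x, hV, (key x hV).2 ho⟩

theorem isTopologicalBasis_imBasis (hP : StronglyDiffOn N (fun x => (P x).1) univ)
    (hU : ∀ x : M, IsOpen (normalBall (N := N) x r)) (hx : ∀ x : M, x ∈ normalBall (N := N) x r)
    (hd : ∀ x : M, ∀ y ∈ normalBall (N := N) x r, ‖(P x).1 - (P y).1‖ ≤ 1 / 4) :
    letI := imSubspaceTopology P
    IsTopologicalBasis (imBasis N P r) := by
  let := imSubspaceTopology P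
  have hbase : Continuous (ImBundle.base (P := P)) := ImBundle.continuous_base
  refine isTopologicalBasis_of_isOpen_of_nhds (fun V hV => ((mem_imBasis_iff hP hU hd).1 hV).2) ?_
  intro ξ V hξ hV
  exact ⟨V ∩ ImBundle.base ⁻¹' normalBall (N := N) ξ.base r,
    (mem_imBasis_iff hP hU hd).2 ⟨⟨ξ.base, inter_subset_right⟩,
      hV.inter ((hU ξ.base).preimage hbase)⟩, ⟨hξ, hx ξ.base⟩, inter_subset_left⟩

/-- Having isomorphic fibres is an equivalence relation whose classes are open, by the local
unitaries; connectedness leaves one class. -/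
theorem nonempty_range_linearIsometryEquiv [ConnectedSpace M]
    (hU : ∀ x : M, IsOpen (normalBall (N := N) x r)) (hx : ∀ x : M, x ∈ normalBall (N := N) x r)
    (hd : ∀ x : M, ∀ y ∈ normalBall (N := N) x r, ‖(P x).1 - (P y).1‖ ≤ 1 / 4) (x y : M) :
    Nonempty ((P x).range ≃ₗᵢ[ℂ] (P y).range) := by
  have hloc : ∀ y, ∀ z ∈ normalBall (N := N) y r, Nonempty ((P y).range ≃ₗᵢ[ℂ] (P z).range) :=
    fun y z hz => (isUnitaryMap_connector
      ((hd y z hz).trans_lt (by norm_num))).nonempty_linearIsometryEquiv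
  have hclopen : IsClopen {y | Nonempty ((P x).range ≃ₗᵢ[ℂ] (P y).range)} := by
    constructor
    · rw [← isOpen_compl_iff, isOpen_iff_mem_nhds]
      intro y hy
      refine Filter.mem_of_superset ((hU y).mem_nhds (hx y)) fun z hz hz' => hy ?_
      obtain ⟨u⟩ := hloc y z hz
      obtain ⟨v⟩ := hz'
      exact ⟨v.trans u.symm⟩
    · rw [isOpen_iff_mem_nhds]
      rintro y ⟨v⟩
      refine Filter.mem_of_superset ((hU y).mem_nhds (hx y)) fun z hz => ?_
      obtain ⟨u⟩ := hloc y z hz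
      exact ⟨v.trans u⟩
  have := hclopen.eq_univ ⟨x, ⟨LinearIsometryEquiv.refl ℂ _⟩⟩
  exact this.symm.subset (mem_univ y)

theorem strongMDirBound_invSqrt_compression (hP : StronglyDiffOn N (fun x => (P x).1) univ) (x : M)
    {U : Set M} (hU : IsOpen U) (hd : ∀ y ∈ U, ‖(P x).1 - (P y).1‖ ≤ 1 / 4) {z : M} (hz : z ∈ U)
    {w : TangentSpace (𝓡 N) z} {b : ℝ} (hb0 : 0 ≤ b)
    (hb : StrongMDirBound (fun x => (P x).1) z w b) :
    StrongMDirBound (fun z => invSqrt (compression (P x) (P z))) z w (invSqrtDerivBound * b) := by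
  have h1 := StrongMDirBound.comp isOpen_univ hP (stronglyDiffOn_const (P x).range.subtypeL _)
    (mem_univ z) hb0 hb (strongMDirBound_const (P x).range.subtypeL z w)
  have h2 := StrongMDirBound.comp isOpen_univ (stronglyDiffOn_const (P x).toRange _)
    (hP.comp isOpen_univ (stronglyDiffOn_const (P x).range.subtypeL _)) (mem_univ z) le_rfl
    (strongMDirBound_const (P x).toRange z w) h1
  have h3 : StrongMDirBound (fun z => compression (P x) (P z)) z w b := by
    refine h2.mono ?_
    calc _ = ‖(P x).toRange‖ * (b * ‖(P x).range.subtypeL‖) := by ring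
      _ ≤ 1 * (b * 1) := by
          gcongr
          · exact (P x).norm_toRange_le
          · exact (P x).norm_subtypeL_le
      _ = b := by ring
  exact StrongMDirBound.invSqrt hU ((stronglyDiffOn_compression hP x).one_sub.mono (subset_univ _))
    (fun _ _ => IsSelfAdjoint.of_nonneg (compression_nonneg _ _))
    (fun z hz => (norm_one_sub_compression_le _ _).trans (hd z hz)) hz hb0
    (h3.one_sub isOpen_univ (stronglyDiffOn_compression hP x) (mem_univ z))

end ImageBundle

-- The Hilbert bundle structure and admissible radii.

section Main

set_option linter.unusedSectionVars false

variable {N : ℕ} {M : Type*} [TopologicalSpace M] [ChartedSpace (EuclideanSpace ℝ (Fin N)) M]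
  [IsManifold (𝓡 N) ∞ M] [RiemannianBundle (fun x : M => TangentSpace (𝓡 N) x)]
  [IsContMDiffRiemannianBundle (𝓡 N) ∞ (EuclideanSpace ℝ (Fin N))
      (fun x : M => TangentSpace (𝓡 N) x)]
  {H : Type*} [NormedAddCommGroup H] [InnerProductSpace ℂ H] [CompleteSpace H]
  {P : M → Projection H}

theorem isHilbertBundle_imTriv [T2Space M] [ConnectedSpace M] [SeparableSpace H] {r s : ℝ}
    (hs : IsBoundedGeometryRadius N M s) (hr : 0 < r) (hrs : r < s)
    (hP : StronglyDiffOn N (fun x => (P x).1) univ)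
    (hU : ∀ x : M, IsOpen (normalBall (N := N) x r))
    (hx : ∀ x : M, x ∈ normalBall (N := N) x r)
    (hd : ∀ x : M, ∀ y ∈ normalBall (N := N) x r, ‖(P x).1 - (P y).1‖ ≤ 1 / 4)
    {L : ℝ} (hL : 0 ≤ L)
    (hPL : ∀ z (w : TangentSpace (𝓡 N) z), StrongMDirBound (fun x => (P x).1) z w (L * ‖w‖)) :
    letI := imSubspaceTopology P
    IsHilbertBundle r (ImBundle.base (P := P)) (fun x => (P x).range) (imTriv N P r) := by
  let := imSubspaceTopology P
  have hunit : ∀ x : M, ∀ y ∈ normalBall (N := N) x r, IsUnitaryMap (connector (P x) (P y)) :=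
    fun x y hy => isUnitaryMap_connector ((hd x y hy).trans_lt (by norm_num))
  refine ⟨hs.mono hr hrs.le, ⟨s, hrs, hs.isInjRadius⟩, fun x => ?_,
    nonempty_range_linearIsometryEquiv hU hx hd, ?_, ImBundle.continuous_base,
    fun x => ⟨⟨x, 0⟩, rfl⟩, isHomeomorph_imTriv hP hU hd, fun _ _ => rfl, ?_⟩
  · have := UniformSpace.secondCountable_of_separable H
    infer_instance
  · have hj : Continuous (ImBundle.toProd (P := P)) := continuous_induced_dom
    exact T2Space.of_injective_continuous ImBundle.toProd_injective hj
  let S : ∀ x : M, M → (P x).range →L[ℂ] (P x).range :=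
    fun x z => invSqrt (compression (P x) (P z))
  let Q : ∀ x y : M, M → (P y).range →L[ℂ] (P x).range :=
    fun x y z => (P x).toRange.comp ((P z).1.comp (P y).range.subtypeL)
  have hPι : ∀ y : M, StronglyDiffOn N (fun z => (P z).1.comp (P y).range.subtypeL) univ :=
    fun y => hP.comp isOpen_univ (stronglyDiffOn_const (P y).range.subtypeL _)
  have hQ : ∀ x y, StronglyDiffOn N (Q x y) univ := fun x y =>
    (stronglyDiffOn_const (P x).toRange _).comp isOpen_univ (hPι y)
  have hUV : ∀ x y : M, IsOpen (normalBall (N := N) x r ∩ normalBall (N := N) y r) :=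
    fun x y => (hU x).inter (hU y)
  have hS1 : ∀ x y, StronglyDiffOn N (S x)
      (normalBall (N := N) x r ∩ normalBall (N := N) y r) := fun x y =>
    (stronglyDiffOn_invSqrt_compression hP x (hU x) (hd x)).mono inter_subset_left
  have hS2 : ∀ x y, StronglyDiffOn N (S y)
      (normalBall (N := N) x r ∩ normalBall (N := N) y r) := fun x y =>
    (stronglyDiffOn_invSqrt_compression hP y (hU y) (hd y)).mono inter_subset_right
  have hQ' : ∀ x y, StronglyDiffOn N (Q x y)
      (normalBall (N := N) x r ∩ normalBall (N := N) y r) := fun x y => (hQ x y).mono (subset_univ _)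
  have hQS : ∀ x y, StronglyDiffOn N (fun z => (Q x y z).comp (S y z))
      (normalBall (N := N) x r ∩ normalBall (N := N) y r) := fun x y =>
    (hQ' x y).comp (hUV x y) (hS2 x y)
  have hnS : ∀ x : M, ∀ z ∈ normalBall (N := N) x r, ‖S x z‖ ≤ invSqrtBound := fun x z hz =>
    norm_invSqrt_le (IsSelfAdjoint.of_nonneg (compression_nonneg _ _))
      ((norm_one_sub_compression_le _ _).trans (hd x z hz))
  have hnP : ∀ y z : M, ‖(P z).1.comp (P y).range.subtypeL‖ ≤ 1 := fun y z =>
    (ContinuousLinearMap.opNorm_comp_le _ _).trans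
      (mul_le_one₀ (P z).2.norm_le (norm_nonneg _) (P y).norm_subtypeL_le)
  have hnQ : ∀ x y z, ‖Q x y z‖ ≤ 1 := fun x y z =>
    (ContinuousLinearMap.opNorm_comp_le _ _).trans
      (mul_le_one₀ (P x).norm_toRange_le (norm_nonneg _) (hnP y z))
  refine ⟨fun x y z => (S x z).comp ((Q x y z).comp (S y z)), fun x y z hz => ?_,
    fun x y ξ hξx hξy => ?_, fun x y => (hS1 x y).comp (hUV x y) (hQS x y), ?_⟩
  · have h := (hunit x z hz.1).adjoint.comp (hunit y z hz.2)
    rw [adjoint_connector] at h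
    exact h
  · have h := congrArg (fun T => T ξ.vec) (hunit y ξ.base hξy).2
    have h2 : ContinuousLinearMap.adjoint (connector (P x) (P ξ.base)) ξ.vec
        = ContinuousLinearMap.adjoint (connector (P x) (P ξ.base)) (connector (P y) (P ξ.base)
          (ContinuousLinearMap.adjoint (connector (P y) (P ξ.base)) ξ.vec)) :=
      congrArg _ h.symm
    refine h2.trans ?_
    conv_lhs => rw [adjoint_connector (P x)]
    rfl
  set κ := invSqrtDerivBound
  set B := invSqrtBound
  have hκ : 0 ≤ κ := invSqrtDerivBound_nonneg
  have hB : 0 ≤ B := invSqrtBound_nonneg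
  -- Leibniz' rule for `S_x Q S_y`: differentiating either outer factor gives `κ L · 1 · B`, the
  -- middle one gives `B · L · B`.
  refine lt_of_le_of_lt (b := ENNReal.ofReal (Real.sqrt N * (L * (2 * κ * B + B * B)))) ?_
    ENNReal.ofReal_lt_top
  refine iSup_le fun x => iSup_le fun y => iSup₂_le fun z hz => ?_
  refine strongDerivNorm_le (by positivity) fun w => ?_
  have hb : 0 ≤ L * ‖w‖ := by positivity
  have h1 := strongMDirBound_invSqrt_compression hP x (hU x) (hd x) hz.1 hb (hPL z w)
  have h2 := strongMDirBound_invSqrt_compression hP y (hU y) (hd y) hz.2 hb (hPL z w)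
  have h3 := StrongMDirBound.comp isOpen_univ hP (stronglyDiffOn_const (P y).range.subtypeL _)
    (mem_univ z) hb (hPL z w) (strongMDirBound_const (P y).range.subtypeL z w)
  have h4 := StrongMDirBound.comp isOpen_univ (stronglyDiffOn_const (P x).toRange _) (hPι y)
    (mem_univ z) le_rfl (strongMDirBound_const (P x).toRange z w) h3
  have h5 : StrongMDirBound (Q x y) z w (L * ‖w‖) := by
    refine h4.mono ?_
    calc _ = ‖(P x).toRange‖ * (L * ‖w‖ * ‖(P y).range.subtypeL‖) := by ring
      _ ≤ 1 * (L * ‖w‖ * 1) := by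
          gcongr
          · exact (P x).norm_toRange_le
          · exact (P y).norm_subtypeL_le
      _ = _ := by ring
  have h6 := StrongMDirBound.comp (hUV x y) (hQ' x y) (hS2 x y) hz hb h5 h2
  have h7 := StrongMDirBound.comp (hUV x y) (hS1 x y) (hQS x y) hz (by positivity) h1 h6
  refine h7.mono ?_
  have h8 : ‖(Q x y z).comp (S y z)‖ ≤ 1 * B :=
    (ContinuousLinearMap.opNorm_comp_le _ _).trans
      (mul_le_mul (hnQ x y z) (hnS y z hz.2) (norm_nonneg _) zero_le_one)
  calc _ ≤ κ * (L * ‖w‖) * (1 * B) + B * (L * ‖w‖ * B + 1 * (κ * (L * ‖w‖))) := by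
        gcongr
        · exact hnS x z hz.1
        · exact hnS y z hz.2
        · exact hnQ x y z
    _ = _ := by ring

/-- The differentials of the exponential maps are uniformly bounded on the balls of radius `s`. -/
theorem IsBoundedGeometryRadius.iSup_dexp_lt_top {s : ℝ} (h : IsBoundedGeometryRadius N M s) :
    ⨆ x : M, ⨆ v ∈ Metric.ball (0 : TangentSpace (𝓡 N) x) s, ‖dexp x v‖ₑ < ⊤ := by
  obtain ⟨C, hC⟩ := h.2
  refine lt_of_le_of_lt (b := ENNReal.ofReal C) ?_ ENNReal.ofReal_lt_top
  refine iSup_le fun x => iSup₂_le fun v hv => ?_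
  obtain ⟨Φ, -, h1, -⟩ := hC x
  rw [← ofReal_norm]
  exact ENNReal.ofReal_le_ofReal (h1 v hv)

theorem IsBoundedGeometryRadius.exists_isAdmissible {s : ℝ} (h : IsBoundedGeometryRadius N M s)
    (hdP : ⨆ x, strongDerivNorm N (fun y => (P y).1) x < ⊤) : ∃ r, IsAdmissible N P s r := by
  have hK := h.iSup_dexp_lt_top
  unfold IsAdmissible
  set Ke := ⨆ x : M, ⨆ v ∈ Metric.ball (0 : TangentSpace (𝓡 N) x) s, ‖dexp x v‖ₑ
  set Le := ⨆ x, strongDerivNorm N (fun y => (P y).1) x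
  obtain ⟨K, hK0, hKe⟩ : ∃ K : ℝ, 0 ≤ K ∧ Ke = ENNReal.ofReal K :=
    ⟨Ke.toReal, ENNReal.toReal_nonneg, (ENNReal.ofReal_toReal hK.ne).symm⟩
  obtain ⟨L, hL0, hLe⟩ : ∃ L : ℝ, 0 ≤ L ∧ Le = ENNReal.ofReal L :=
    ⟨Le.toReal, ENNReal.toReal_nonneg, (ENNReal.ofReal_toReal hdP.ne).symm⟩
  have hs := h.1
  -- The summands `+ 1` allow `K` or `L` to vanish; the `8` leaves `4 r K L` at most `1/2`.
  refine ⟨min (s / 2) (1 / (8 * (K + 1) * (L + 1))), h, by positivity,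
    (min_le_left _ _).trans_lt (by linarith), ?_⟩
  set r := min (s / 2) (1 / (8 * (K + 1) * (L + 1)))
  have hr : r ≤ 1 / (8 * (K + 1) * (L + 1)) := min_le_right _ _
  have hr0 : 0 ≤ r := by positivity
  rw [hKe, hLe, show (4 : ℝ≥0∞) = ENNReal.ofReal 4 by simp,
    ← ENNReal.ofReal_mul (by positivity), ← ENNReal.ofReal_mul (by positivity),
    ← ENNReal.ofReal_mul (by positivity), ENNReal.ofReal_lt_one]
  rw [le_div_iff₀ (by positivity)] at hr
  nlinarith [mul_nonneg hr0 hK0, mul_nonneg hr0 hL0, mul_nonneg (mul_nonneg hr0 hK0) hL0]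

/-- The radial estimate for each `P ξ` gives `L K r ‖ξ‖`. The factor `4` in admissibility is spent
here, to land in the `1/4`-ball where the binomial series is controlled. -/
theorem IsAdmissible.norm_sub_le {s r : ℝ} (h : IsAdmissible N P s r)
    (hP : StronglyDiffOn N (fun x => (P x).1) univ)
    (hdP : ⨆ x, strongDerivNorm N (fun y => (P y).1) x < ⊤)
    (hPL : ∀ z (w : TangentSpace (𝓡 N) z), StrongMDirBound (fun x => (P x).1) z w
      ((⨆ x, strongDerivNorm N (fun y => (P y).1) x).toReal * ‖w‖))
    {x y : M} (hy : y ∈ normalBall (N := N) x r) : ‖(P x).1 - (P y).1‖ ≤ 1 / 4 := by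
  obtain ⟨hs, hr, hrs, hlt⟩ := h
  have hK := hs.iSup_dexp_lt_top
  set Ke := ⨆ x : M, ⨆ v ∈ Metric.ball (0 : TangentSpace (𝓡 N) x) s, ‖dexp x v‖ₑ with hKe
  set Le := ⨆ x, strongDerivNorm N (fun y => (P y).1) x
  rw [← ENNReal.ofReal_toReal hK.ne, ← ENNReal.ofReal_toReal hdP.ne,
    show (4 : ℝ≥0∞) = ENNReal.ofReal 4 by simp,
    ← ENNReal.ofReal_mul (by positivity), ← ENNReal.ofReal_mul (by positivity),
    ← ENNReal.ofReal_mul (by positivity), ENNReal.ofReal_lt_one] at hlt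
  obtain ⟨C, hC⟩ := hs.2
  obtain ⟨Φ, hΦ, -⟩ := hC x
  have hexp : ∀ v ∈ Metric.ball (0 : TangentSpace (𝓡 N) x) s, ‖dexp x v‖ ≤ Ke.toReal := by
    intro v hv
    rw [← ENNReal.ofReal_le_iff_le_toReal hK.ne]
    exact (ofReal_norm (dexp x v)).trans_le (le_iSup_of_le x (le_iSup₂_of_le v hv le_rfl))
  rw [norm_sub_rev]
  refine ContinuousLinearMap.opNorm_le_bound _ (by norm_num) fun ξ => ?_
  have h1 := hΦ.norm_sub_le hr hrs.le (g := fun y => (P y).1 ξ) (L := Le.toReal * ‖ξ‖)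
    (K := Ke.toReal) (by positivity) ENNReal.toReal_nonneg
    (fun y => hP.mdifferentiableAt isOpen_univ (mem_univ y) ξ)
    (fun y w => (hPL y w ξ).trans_eq (by ring)) hexp hy
  change ‖(P y).1 ξ - (P x).1 ξ‖ ≤ _
  refine h1.trans ?_
  calc Le.toReal * ‖ξ‖ * (Ke.toReal * r) = (4 * r * Ke.toReal * Le.toReal) / 4 * ‖ξ‖ := by ring
    _ ≤ 1 / 4 * ‖ξ‖ := by gcongr

end Main

end

-- Assembly of the theorem.

theorem theoremt {N : ℕ} {M : Type*} [TopologicalSpace M]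
    [ChartedSpace (EuclideanSpace ℝ (Fin N)) M] [IsManifold (𝓡 N) ∞ M]
    [T2Space M] [SecondCountableTopology M] [ConnectedSpace M]
    [RiemannianBundle (fun x : M => TangentSpace (𝓡 N) x)]
    [IsContMDiffRiemannianBundle (𝓡 N) ∞ (EuclideanSpace ℝ (Fin N))
      (fun x : M => TangentSpace (𝓡 N) x)]
    (hM : BoundedGeometry N M)
    {H : Type*} [NormedAddCommGroup H] [InnerProductSpace ℂ H] [CompleteSpace H] [SeparableSpace H]
    (P : M → Projection H)
    (hP : StronglyDiffOn N (fun x => (P x).1) univ)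
    (hdP : ⨆ x, strongDerivNorm N (fun y => (P y).1) x < ⊤) :
    (∃ s r, IsAdmissible N P s r) ∧
    ∀ s r, IsAdmissible N P s r →
      (∀ x, ∀ y ∈ normalBall (N := N) x r,
        IsUnit (compression (P x) (P y)) ∧ IsUnitaryMap (connector (P x) (P y))) ∧
      letI : TopologicalSpace (ImBundle P) := imTopology N P r
      IsTopologicalBasis (imBasis N P r) ∧
      IsHilbertBundle r (ImBundle.base (P := P)) (fun x => (P x).range) (imTriv N P r) ∧
      ∀ (x₀ : M) (u : ∀ x, (P x).range ≃ₗᵢ[ℂ] (P x₀).range),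
        IsHilbertBundle r (ImBundle.base (P := P)) (fun _ => (P x₀).range)
          (fun x ξ => ((imTriv N P r x ξ).1, u x (imTriv N P r x ξ).2)) := by
  have hPL : ∀ z (w : TangentSpace (𝓡 N) z), StrongMDirBound (fun x => (P x).1) z w
      ((⨆ x, strongDerivNorm N (fun y => (P y).1) x).toReal * ‖w‖) := fun z w =>
    strongMDirBound_of_strongDerivNorm_le isOpen_univ hP (mem_univ z) ENNReal.toReal_nonneg
      (by rw [ENNReal.ofReal_toReal hdP.ne]; exact le_iSup_of_le z le_rfl) w
  constructor
  · obtain ⟨s, hs⟩ := hM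
    exact ⟨s, hs.exists_isAdmissible hdP⟩
  intro s r h
  have hd : ∀ x : M, ∀ y ∈ normalBall (N := N) x r, ‖(P x).1 - (P y).1‖ ≤ 1 / 4 :=
    fun x y hy => h.norm_sub_le hP hdP hPL hy
  obtain ⟨hs, hr, hrs, -⟩ := h
  have hchart := (hs.mono hr hrs.le).isInjRadius
  have hU : ∀ x : M, IsOpen (normalBall (N := N) x r) := fun x => by
    obtain ⟨Φ, hΦ⟩ := hchart.2 x
    exact hΦ.isOpen_normalBall
  have hx : ∀ x : M, x ∈ normalBall (N := N) x r := fun x => by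
    obtain ⟨Φ, hΦ⟩ := hchart.2 x
    exact hΦ.mem_normalBall hr
  refine ⟨fun x y hy => ?_, ?_⟩
  · have hlt : ‖(P x).1 - (P y).1‖ < 1 := (hd x y hy).trans_lt (by norm_num)
    exact ⟨isUnit_compression hlt, isUnitaryMap_connector hlt⟩
  have hbasis := isTopologicalBasis_imBasis hP hU hx hd
  -- A topology is generated by any of its bases, so the prescribed topology is the subspace
  -- topology, where the bundle properties are already established.
  have htop : imTopology N P r = imSubspaceTopology P :=
    (IsTopologicalBasis.eq_generateFrom (t := imSubspaceTopology P) hbasis).symm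
  have hbundle := isHilbertBundle_imTriv hs hr hrs hP hU hx hd ENNReal.toReal_nonneg hPL
  rw [htop]
  let := imSubspaceTopology P
  exact ⟨hbasis, hbundle, fun x₀ u => hbundle.postcomp hU u⟩
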